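/- Let $1<q<p$ be real numbers and let $(X,\mu)$ be a non-atomic probability space. Let $\mathcal T$ be a tree on $X$, i.e. a family of measurable sets of positive measure with $X\in\mathcal T$ such that: every $I\in\mathcal T$ is the union of a finite or countable family $C(I)\subseteq\mathcal T$ of at least two subsets of $I$ that pairwise intersect in null sets; $\mathcal T=\bigcup_{m\ge 0}\mathcal T_{(m)}$, where $\mathcal T_{(0)}=\{X\}$ and $\mathcal T_{(m+1)}=\bigcup_{I\in\mathcal T_{(m)}}C(I)$; and $\lim_{m\to\infty}\sup_{I\in\mathcal T_{(m)}}\mu(I)=0$. Put $\mathcal M\varphi(x)=\sup\{\frac1{\mu(I)}\int_I|\varphi|\,d\mu: x\in I\in\mathcal T\}$, $\|\varphi\|_{p,\infty}=\sup_{t>0}t\,\mu(\{\varphi\ge t\})^{1/p}$, and $$B_1(f,A,\lambda)=\sup\Big\{\mu(\{\mathcal M\varphi\ge\lambda\}):\ \varphi\ge0 \text{ measurable},\ \int_X\varphi\,d\mu=f,\ \int_X\varphi^q\,d\mu=A,\ \|\varphi\|_{p,\infty}\le\tfrac{p-1}p\Big\}.$$ Write $\kappa=\frac{p-1}p$, $r=\frac{p-q}{p-1}$,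 $\Gamma=\kappa^q\frac p{p-q}$, and for $0<f\le1$ let $A_f=f^q$ if $f\le\kappa$ and $A_f=\frac{\kappa^q}{p-q}\big(p-q[p(1-f)]^{r}\big)$ if $f>\kappa$. Let $D$ be the set of all $(f,A)$ with $0<f\le1$ and $A_f\le A\le\Gamma f^{r}$. For $\lambda>f$ define the following functions. - For $0\le\beta\le\lambda^{-p}$: $S_\lambda(\beta)=\Gamma(\lambda\beta)^{r}$, and $$T_\lambda(\beta)=\begin{cases}\lambda^q\beta,&\beta\le(\kappa/\lambda)^p,\\ \frac{\kappa^q}{p-q}\Big(p\,\beta^{1-q/p}-q\big[p(\beta^{1-1/p}-\lambda\beta)\big]^{r}\Big),&(\kappa/\lambda)^p<\beta\le\lambda^{-p}.\end{cases}$$ - For $0\le\beta\le f/\lambda$ with $f-\lambda\beta\le1-\beta^{1-1/p}$: $F_\lambda(\beta)=\frac{(f-\lambda\beta)^q}{(1-\beta)^{q-1}}$ if $f\le\kappa$ or $\beta\ge\frac{f-\kappa}{\lambda-\kappa}$; otherwise $F_\lambda(\beta)=\kappa^qc^{-q/p}(c-\beta)+\Gamma(1-c^{1-q/p})$, where $c$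 is the unique solution in $[\beta,1]$ of $\frac1pc^{1-1/p}+\big(1-\frac1p\big)\beta c^{-1/p}=1-(f-\lambda\beta)$. **Theorem.** Let $(f,A)\in D$ with $A>A_f$. The equation $$F_\lambda(1/\lambda^p)+\frac{\Gamma}{\lambda^{p-q}}=A$$ has exactly one root $\lambda_1$ in $\big[(1/f)^{1/(p-1)},\infty\big)$, and $\lambda_1>(1/f)^{1/(p-1)}$ if $A<\Gamma f^{r}$. Moreover: (i) $B_1(f,A,\lambda)=1/\lambda^p$ for every $\lambda\ge\lambda_1$. (ii) For every $\lambda$ with $f<\lambda<\lambda_1$, $B_1(f,A,\lambda)$ equals the supremum of all $\beta\ge0$ such that $\beta\le\min(f/\lambda,1/\lambda^p)$, $f-\lambda\beta\le1-\beta^{1-1/p}$ and $T_\lambda(\beta)\le A-F_\lambda(\beta)\le S_\lambda(\beta)$ (a nonempty set). -/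

import Mathlib

open MeasureTheory Set Filter Topology
open scoped ENNReal

namespace DyadicWeakType

noncomputable section

/-- A measure without atoms: every measurable set of positive measure contains a measurable
subset of strictly smaller positive measure. -/
def IsNonatomic {X : Type*} [MeasurableSpace X] (μ : Measure X) : Prop :=
  ∀ s : Set X, MeasurableSet s → 0 < μ s →
    ∃ t : Set X, t ⊆ s ∧ MeasurableSet t ∧ 0 < μ t ∧ μ t < μ s

/-- The generations of the family generated from the whole space by the children map `C`. -/
def treeLevel {X : Type*} (C : Set X → Set (Set X)) : ℕ → Set (Set X)
  | 0 => {univ}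
  | m + 1 => ⋃ I ∈ treeLevel C m, C I

/-- `T` is a tree of measurable sets of `(X, μ)`, where `C I` is the set of children of `I`. -/
structure IsTree {X : Type*} [MeasurableSpace X] (μ : Measure X)
    (T : Set (Set X)) (C : Set X → Set (Set X)) : Prop where
  measurableSet : ∀ I ∈ T, MeasurableSet I
  univ_mem : univ ∈ T
  measure_pos : ∀ I ∈ T, 0 < μ I
  children_subset : ∀ I ∈ T, C I ⊆ T
  children_countable : ∀ I ∈ T, (C I).Countable
  /-- at least two children -/
  children_nontrivial : ∀ I ∈ T, (C I).Nontrivial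
  subset_of_mem_children : ∀ I ∈ T, ∀ J ∈ C I, J ⊆ I
  /-- distinct children meet in a null set -/
  children_aedisjoint : ∀ I ∈ T, (C I).Pairwise (AEDisjoint μ)
  eq_sUnion_children : ∀ I ∈ T, I = ⋃₀ C I
  eq_iUnion_level : T = ⋃ m, treeLevel C m
  tendsto_level : Tendsto (fun m => ⨆ I ∈ treeLevel C m, μ I) atTop (𝓝 0)

/-- The maximal operator of the family `T`, with values in `[0, ∞]`. -/
def maximalFn {X : Type*} [MeasurableSpace X] (μ : Measure X) (T : Set (Set X))
    (φ : X → ℝ) (x : X) : ℝ≥0∞ :=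
  ⨆ I ∈ T, ⨆ _ : x ∈ I, (∫⁻ y in I, ENNReal.ofReal |φ y| ∂μ) / μ I

/-- The quasi-norm `‖φ‖_{p,∞} = sup_{t > 0} t μ({φ ≥ t})^{1/p}` of a nonnegative function. -/
def weakNorm {X : Type*} [MeasurableSpace X] (μ : Measure X) (p : ℝ) (φ : X → ℝ) : ℝ≥0∞ :=
  ⨆ t : ℝ, ⨆ _ : 0 < t, ENNReal.ofReal t * (μ {x | t ≤ φ x}) ^ (1 / p)

/-- The functions over which the extremal problem runs: `φ ≥ 0`, `∫ φ = f`, `∫ φ^q = A`,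
`‖φ‖_{p,∞} ≤ (p-1)/p`. -/
structure IsAdmissible {X : Type*} [MeasurableSpace X] (μ : Measure X) (p q f A : ℝ)
    (φ : X → ℝ) : Prop where
  measurable : Measurable φ
  nonneg : ∀ x, 0 ≤ φ x
  integrable : Integrable φ μ
  integral_eq : ∫ x, φ x ∂μ = f
  integrable_rpow : Integrable (fun x => φ x ^ q) μ
  integral_rpow_eq : ∫ x, φ x ^ q ∂μ = A
  weakNorm_le : weakNorm μ p φ ≤ ENNReal.ofReal ((p - 1) / p)

/-- `B₁(f, A, l)`: the supremum of `μ({Mφ ≥ l})` over the admissible `φ`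
(a set of numbers in `[0, 1]` when `μ` is a probability measure). -/
def B1 {X : Type*} [MeasurableSpace X] (μ : Measure X) (T : Set (Set X)) (p q f A l : ℝ) : ℝ :=
  sSup {b : ℝ | ∃ φ : X → ℝ, IsAdmissible μ p q f A φ ∧
    b = μ.real {x | ENNReal.ofReal l ≤ maximalFn μ T φ x}}

/-- The constant `Γ`. -/
def Gam (p q : ℝ) : ℝ := ((p - 1) / p) ^ q * (p / (p - q))

/-- The least possible value `A_f` of `∫ φ^q` for given `f`. -/
def Amin (p q f : ℝ) : ℝ :=
  if f ≤ (p - 1) / p then f ^ q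
  else ((p - 1) / p) ^ q * (1 / (p - q)) *
    (p - q * (p * (1 - f)) ^ ((p - q) / (p - 1)))

/-- The domain `D` of the extremal problem. -/
def D (p q : ℝ) : Set (ℝ × ℝ) :=
  {z | 0 < z.1 ∧ z.1 ≤ 1 ∧ Amin p q z.1 ≤ z.2 ∧
    z.2 ≤ Gam p q * z.1 ^ ((p - q) / (p - 1))}

/-- `T_l(a)`; the second line is the function `Δ` for the mean `f₁ = l * a`. -/
def Tfun (p q l a : ℝ) : ℝ :=
  if a ≤ (((p - 1) / p) / l) ^ p then l ^ q * a
  else ((p - 1) / p) ^ q * (1 / (p - q)) *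
    (p * a ^ (1 - q / p) - q * (p * (a ^ (1 - 1 / p) - l * a)) ^ ((p - q) / (p - 1)))

/-- `S_l(a)`. -/
def Sfun (p q l a : ℝ) : ℝ := Gam p q * (l * a) ^ ((p - q) / (p - 1))

/-- The solution `c ∈ [a, 1]` of `(1/p) c^(1-1/p) + (1-1/p) a c^(-1/p) = 1 - f₂`. Its left side
is strictly increasing in `c ∈ [a, 1]`, so there is exactly one solution when `a ∈ [0, 1]` and
`(1-a)(p-1)/p ≤ f₂ ≤ 1 - a^(1-1/p)`, and the infimum is taken over a singleton. -/
def cSol (p a f₂ : ℝ) : ℝ :=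
  sInf {c : ℝ | a ≤ c ∧ c ≤ 1 ∧
    (1 / p) * c ^ (1 - 1 / p) + (1 - 1 / p) * a * c ^ (-(1 / p)) = 1 - f₂}

/-- The function `Γ_{f₂}(a)`. -/
def GamFun (p q f₂ a : ℝ) : ℝ :=
  ((p - 1) / p) ^ q * cSol p a f₂ ^ (-(q / p)) * (cSol p a f₂ - a)
    + Gam p q * (1 - cSol p a f₂ ^ (1 - q / p))

/-- `F_l(a)`, for `l > f`, `0 ≤ a ≤ f / l` and `f - l * a ≤ 1 - a^(1-1/p)`. -/
def Ffun (p q f l a : ℝ) : ℝ :=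
  if f ≤ (p - 1) / p then (f - l * a) ^ q / (1 - a) ^ (q - 1)
  else if (f - (p - 1) / p) / (l - (p - 1) / p) ≤ a then
    (f - l * a) ^ q / (1 - a) ^ (q - 1)
  else GamFun p q (f - l * a) a

end

end DyadicWeakType

open DyadicWeakType

namespace DyadicWeakType

noncomputable section

/-! ### The extremal profile `κ t ^ (-1/p)` and its truncations -/

/-- The decreasing function on `(0, 1]` whose weak norm is exactly `(p-1)/p`. -/
def envelope (p t : ℝ) : ℝ := (p - 1) / p * t ^ (-(1 / p))

/-- The envelope cut off at height `v`. -/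
def trunc (p v t : ℝ) : ℝ := min v (envelope p t)

/-- Nonnegative measurable functions lying below the envelope on `(0, 1]`. -/
structure IsProfile (p : ℝ) (ψ : ℝ → ℝ) : Prop where
  measurable : Measurable ψ
  nonneg : ∀ t ∈ Ioc (0 : ℝ) 1, 0 ≤ ψ t
  le_envelope : ∀ t ∈ Ioc (0 : ℝ) 1, ψ t ≤ envelope p t

/-- Bernoulli's inequality in `x / m`; the case `m = 0` is separate because of the division. -/
theorem tangent_le_rpow {q x m : ℝ} (hq : 1 < q) (hx : 0 ≤ x) (hm : 0 ≤ m) :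
    m ^ q + q * m ^ (q - 1) * (x - m) ≤ x ^ q := by
  rcases hm.eq_or_lt with rfl | hm
  · rw [Real.zero_rpow (by linarith), Real.zero_rpow (by linarith)]
    simpa using Real.rpow_nonneg hx q
  · have h := one_add_mul_self_le_rpow_one_add (s := x / m - 1)
      (by have := div_nonneg hx hm.le; linarith) hq.le
    have e : (1 + (x / m - 1)) ^ q = x ^ q / m ^ q := by
      rw [show 1 + (x / m - 1) = x / m by ring, Real.div_rpow hx hm.le]
    rw [e, le_div_iff₀ (by positivity)] at h
    rw [Real.rpow_sub_one hm.ne']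
    refine le_trans (le_of_eq ?_) h
    field_simp

theorem tangent_lt_rpow {q x m : ℝ} (hq : 1 < q) (hx : 0 ≤ x) (hm : 0 ≤ m) (hne : x ≠ m) :
    m ^ q + q * m ^ (q - 1) * (x - m) < x ^ q := by
  rcases hm.eq_or_lt with rfl | hm
  · rw [Real.zero_rpow (by linarith), Real.zero_rpow (by linarith)]
    simpa using Real.rpow_pos_of_pos (hx.lt_of_ne' hne) q
  · have h := one_add_mul_self_lt_rpow_one_add (s := x / m - 1)
      (by have := div_nonneg hx hm.le; linarith)
      (by intro h; apply hne; field_simp at h; linarith) hq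
    have e : (1 + (x / m - 1)) ^ q = x ^ q / m ^ q := by
      rw [show 1 + (x / m - 1) = x / m by ring, Real.div_rpow hx hm.le]
    rw [e, lt_div_iff₀ (by positivity)] at h
    rw [Real.rpow_sub_one hm.ne']
    refine lt_of_eq_of_lt ?_ h
    field_simp

/-! ### Masses and moments of the envelope and of its truncations; minimality of truncations. -/

section Envelope

variable {p q : ℝ}

theorem envelope_nonneg (hp : 1 < p) {t : ℝ} (ht : 0 ≤ t) : 0 ≤ envelope p t :=
  mul_nonneg (div_nonneg (by linarith) (by linarith)) (Real.rpow_nonneg ht _)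

theorem envelope_pos (hp : 1 < p) {t : ℝ} (ht : 0 < t) : 0 < envelope p t :=
  mul_pos (div_pos (by linarith) (by linarith)) (Real.rpow_pos_of_pos ht _)

theorem envelope_strictAnti (hp : 1 < p) {s t : ℝ} (hs : 0 < s) (hst : s < t) :
    envelope p t < envelope p s :=
  mul_lt_mul_of_pos_left
    (Real.rpow_lt_rpow_of_neg hs hst (neg_lt_zero.2 (by positivity)))
    (div_pos (by linarith) (by linarith))

theorem envelope_anti (hp : 1 < p) {s t : ℝ} (hs : 0 < s) (hst : s ≤ t) :
    envelope p t ≤ envelope p s := by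
  rcases hst.eq_or_lt with rfl | h
  · rfl
  · exact (envelope_strictAnti hp hs h).le

theorem measurable_envelope : Measurable (envelope p) := by
  unfold envelope; fun_prop

theorem envelope_one : envelope p 1 = (p - 1) / p := by simp [envelope]

theorem envelope_rpow (hp : 1 < p) {t : ℝ} (ht : 0 ≤ t) :
    envelope p t ^ q = ((p - 1) / p) ^ q * t ^ (-(q / p)) := by
  rw [envelope, Real.mul_rpow (div_nonneg (by linarith) (by linarith)) (Real.rpow_nonneg ht _),
    ← Real.rpow_mul ht]
  congr 2
  ring

theorem intervalIntegrable_envelope (hp : 1 < p) (a b : ℝ) :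
    IntervalIntegrable (envelope p) volume a b := by
  refine (intervalIntegral.intervalIntegrable_rpow' ?_).const_mul _
  have : 1 / p < 1 := by rw [div_lt_one (by linarith)]; exact hp
  linarith

theorem integral_envelope (hp : 1 < p) (a b : ℝ) :
    ∫ t in a..b, envelope p t = b ^ (1 - 1 / p) - a ^ (1 - 1 / p) := by
  have h1 : 1 / p < 1 := by rw [div_lt_one (by linarith)]; exact hp
  unfold envelope
  rw [intervalIntegral.integral_const_mul, integral_rpow (Or.inl (by linarith)),
    show -(1 / p) + 1 = 1 - 1 / p by ring]
  have : p - 1 ≠ 0 := by linarith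
  have : p ≠ 0 := by linarith
  field_simp

theorem integral_envelope_rpow (hq : 1 < q) (hqp : q < p) {a b : ℝ} (ha : 0 ≤ a) (hb : 0 ≤ b) :
    ∫ t in a..b, envelope p t ^ q = Gam p q * (b ^ (1 - q / p) - a ^ (1 - q / p)) := by
  have hp : 0 < p := by linarith
  have h1 : q / p < 1 := by rw [div_lt_one (by linarith)]; exact hqp
  have e : ∫ t in a..b, envelope p t ^ q =
      ∫ t in a..b, ((p - 1) / p) ^ q * t ^ (-(q / p)) := by
    refine intervalIntegral.integral_congr fun t ht => envelope_rpow (by linarith) ?_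
    exact (le_min ha hb).trans ht.1
  rw [e, intervalIntegral.integral_const_mul, integral_rpow (Or.inl (by linarith)),
    show -(q / p) + 1 = 1 - q / p by ring, Gam]
  have : p - q ≠ 0 := by linarith
  field_simp

theorem isProfile_envelope (hp : 1 < p) : IsProfile p (envelope p) :=
  ⟨measurable_envelope, fun _ ht => envelope_nonneg hp ht.1.le, fun _ _ => le_rfl⟩

theorem isProfile_trunc (hp : 1 < p) {v : ℝ} (hv : 0 ≤ v) : IsProfile p (trunc p v) :=
  ⟨measurable_const.min measurable_envelope,
    fun _ ht => le_min hv (envelope_nonneg hp ht.1.le), fun _ _ => min_le_right _ _⟩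

theorem integrableOn_envelope_rpow (hq : 1 < q) (hqp : q < p) :
    IntegrableOn (fun t => envelope p t ^ q) (Ioc 0 1) := by
  have h1 : q / p < 1 := by rw [div_lt_one (by linarith)]; exact hqp
  have h : IntegrableOn (fun t : ℝ => ((p - 1) / p) ^ q * t ^ (-(q / p))) (Ioc 0 1) := by
    rw [← intervalIntegrable_iff_integrableOn_Ioc_of_le zero_le_one]
    exact (intervalIntegral.intervalIntegrable_rpow' (by linarith)).const_mul _
  exact h.congr_fun (fun t ht => (envelope_rpow (by linarith) ht.1.le).symm) measurableSet_Ioc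

theorem IsProfile.integrableOn {ψ : ℝ → ℝ} (hψ : IsProfile p ψ) (hp : 1 < p) :
    IntegrableOn ψ (Ioc 0 1) := by
  have h : IntegrableOn (envelope p) (Ioc 0 1) := by
    rw [← intervalIntegrable_iff_integrableOn_Ioc_of_le zero_le_one]
    exact intervalIntegrable_envelope hp 0 1
  refine Integrable.mono' h hψ.measurable.aestronglyMeasurable ?_
  filter_upwards [ae_restrict_mem measurableSet_Ioc] with t ht
  rw [Real.norm_of_nonneg (hψ.nonneg t ht)]
  exact hψ.le_envelope t ht

theorem IsProfile.integrableOn_rpow {ψ : ℝ → ℝ} (hψ : IsProfile p ψ) (hq : 1 < q) (hqp : q < p) :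
    IntegrableOn (fun t => ψ t ^ q) (Ioc 0 1) := by
  refine Integrable.mono' (integrableOn_envelope_rpow hq hqp)
    (hψ.measurable.pow_const q).aestronglyMeasurable ?_
  filter_upwards [ae_restrict_mem measurableSet_Ioc] with t ht
  rw [Real.norm_of_nonneg (Real.rpow_nonneg (hψ.nonneg t ht) _)]
  exact Real.rpow_le_rpow (hψ.nonneg t ht) (hψ.le_envelope t ht) (by linarith)

theorem IsProfile.intervalIntegrable {ψ : ℝ → ℝ} (hψ : IsProfile p ψ) (hp : 1 < p) {a b : ℝ}
    (ha : 0 ≤ a) (hab : a ≤ b) (hb : b ≤ 1) : IntervalIntegrable ψ volume a b := by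
  rw [intervalIntegrable_iff_integrableOn_Ioc_of_le hab]
  exact (hψ.integrableOn hp).mono_set (Ioc_subset_Ioc ha hb)

theorem IsProfile.intervalIntegrable_rpow {ψ : ℝ → ℝ} (hψ : IsProfile p ψ) (hq : 1 < q)
    (hqp : q < p) {a b : ℝ} (ha : 0 ≤ a) (hab : a ≤ b) (hb : b ≤ 1) :
    IntervalIntegrable (fun t => ψ t ^ q) volume a b := by
  rw [intervalIntegrable_iff_integrableOn_Ioc_of_le hab]
  exact (hψ.integrableOn_rpow hq hqp).mono_set (Ioc_subset_Ioc ha hb)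

theorem IsProfile.integral_le {ψ : ℝ → ℝ} (hψ : IsProfile p ψ) (hp : 1 < p) {a b : ℝ}
    (ha : 0 ≤ a) (hab : a ≤ b) (hb : b ≤ 1) :
    ∫ t in a..b, ψ t ≤ b ^ (1 - 1 / p) - a ^ (1 - 1 / p) := by
  rw [← integral_envelope hp]
  refine intervalIntegral.integral_mono_on_of_le_Ioo hab (hψ.intervalIntegrable hp ha hab hb)
    (intervalIntegrable_envelope hp a b) fun t ht => hψ.le_envelope t ⟨by linarith [ht.1], by linarith [ht.2]⟩

theorem integral_trunc (hp : 1 < p) {a b c : ℝ} (ha : 0 ≤ a) (hc : 0 < c) (hac : a ≤ c)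
    (hcb : c ≤ b) (hb : b ≤ 1) :
    ∫ t in a..b, trunc p (envelope p c) t =
      envelope p c * (c - a) + (b ^ (1 - 1 / p) - c ^ (1 - 1 / p)) := by
  have hprof := isProfile_trunc hp (envelope_nonneg hp hc.le)
  rw [← intervalIntegral.integral_add_adjacent_intervals
    (hprof.intervalIntegrable hp ha hac (hcb.trans hb))
    (hprof.intervalIntegrable hp hc.le hcb hb), ← integral_envelope hp c b]
  congr 1
  · rw [intervalIntegral.integral_congr_Ioo_of_le (g := fun _ => envelope p c) hac]
    · simp [mul_comm]
    · intro t ht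
      exact min_eq_left (envelope_anti hp (by linarith [ht.1]) ht.2.le)
  · refine intervalIntegral.integral_congr_Ioo_of_le hcb ?_
    intro t ht
    exact min_eq_right (envelope_anti hp hc ht.1.le)

theorem integral_trunc_rpow (hq : 1 < q) (hqp : q < p) {a b c : ℝ} (ha : 0 ≤ a) (hc : 0 < c)
    (hac : a ≤ c) (hcb : c ≤ b) (hb : b ≤ 1) :
    ∫ t in a..b, trunc p (envelope p c) t ^ q =
      envelope p c ^ q * (c - a) + Gam p q * (b ^ (1 - q / p) - c ^ (1 - q / p)) := by
  have hp : 1 < p := by linarith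
  have hprof := isProfile_trunc hp (envelope_nonneg hp hc.le)
  rw [← intervalIntegral.integral_add_adjacent_intervals
    (hprof.intervalIntegrable_rpow hq hqp ha hac (hcb.trans hb))
    (hprof.intervalIntegrable_rpow hq hqp hc.le hcb hb),
    ← integral_envelope_rpow hq hqp hc.le (hc.le.trans hcb)]
  congr 1
  · rw [intervalIntegral.integral_congr_Ioo_of_le (g := fun _ => envelope p c ^ q) hac]
    · simp [mul_comm]
    · intro t ht
      exact congrArg (· ^ q) (min_eq_left (envelope_anti hp (by linarith [ht.1]) ht.2.le))
  · refine intervalIntegral.integral_congr_Ioo_of_le hcb ?_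
    intro t ht
    exact congrArg (· ^ q) (min_eq_right (envelope_anti hp hc ht.1.le))

theorem integral_trunc_of_le (hp : 1 < p) {a b v : ℝ} (ha : 0 ≤ a) (hab : a ≤ b)
    (hv : v ≤ envelope p b) : ∫ t in a..b, trunc p v t = v * (b - a) := by
  rw [intervalIntegral.integral_congr_Ioo_of_le (g := fun _ => v) hab]
  · simp [mul_comm]
  · intro t ht
    exact min_eq_left (hv.trans (envelope_anti hp (by linarith [ht.1]) ht.2.le))

theorem integral_trunc_rpow_of_le (hp : 1 < p) {a b v : ℝ} (ha : 0 ≤ a) (hab : a ≤ b)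
    (hv : v ≤ envelope p b) : ∫ t in a..b, trunc p v t ^ q = v ^ q * (b - a) := by
  rw [intervalIntegral.integral_congr_Ioo_of_le (g := fun _ => v ^ q) hab]
  · simp [mul_comm]
  · intro t ht
    exact congrArg (· ^ q)
      (min_eq_left (hv.trans (envelope_anti hp (by linarith [ht.1]) ht.2.le)))

/-- A tangent inequality with a slope independent of `t`, a Lagrange multiplier for the mass. Where
the envelope is below `v`, the profile cannot exceed the truncation, so raising the slope to `q v ^
(q - 1)` only lowers the left side. -/
theorem tangent_trunc_le (hq : 1 < q) {ψ : ℝ → ℝ} (hψ : IsProfile p ψ) (hp : 1 < p)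
    {v t : ℝ} (hv : 0 ≤ v) (ht : t ∈ Ioc (0 : ℝ) 1) :
    trunc p v t ^ q + q * v ^ (q - 1) * (ψ t - trunc p v t) ≤ ψ t ^ q := by
  have h0 : 0 ≤ trunc p v t := (isProfile_trunc hp hv).nonneg t ht
  have h1 := tangent_le_rpow hq (hψ.nonneg t ht) h0
  rcases le_total v (envelope p t) with h | h
  · rwa [show trunc p v t = v from min_eq_left h] at h1 ⊢
  · have e : trunc p v t = envelope p t := min_eq_right h
    refine le_trans ?_ h1
    have h2 : trunc p v t ^ (q - 1) ≤ v ^ (q - 1) :=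
      Real.rpow_le_rpow h0 (min_le_left _ _) (by linarith)
    have h3 : ψ t - trunc p v t ≤ 0 := by rw [e]; linarith [hψ.le_envelope t ht]
    have := mul_le_mul_of_nonpos_right
      (mul_le_mul_of_nonneg_left h2 (by linarith : (0 : ℝ) ≤ q)) h3
    linarith

/-- Truncations of the envelope minimize the `q`-th moment among profiles of the same mass. -/
theorem integral_trunc_rpow_le (hq : 1 < q) (hqp : q < p) {ψ : ℝ → ℝ} (hψ : IsProfile p ψ)
    {a b v : ℝ} (ha : 0 ≤ a) (hab : a ≤ b) (hb : b ≤ 1) (hv : 0 ≤ v)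
    (hle : ∫ t in a..b, trunc p v t ≤ ∫ t in a..b, ψ t) :
    ∫ t in a..b, trunc p v t ^ q ≤ ∫ t in a..b, ψ t ^ q := by
  have hp : 1 < p := by linarith
  have hT := isProfile_trunc hp hv
  have i1 := hT.intervalIntegrable hp ha hab hb
  have i2 := hT.intervalIntegrable_rpow hq hqp ha hab hb
  have i3 := hψ.intervalIntegrable hp ha hab hb
  have i4 := hψ.intervalIntegrable_rpow hq hqp ha hab hb
  have h := intervalIntegral.integral_mono_on_of_le_Ioo hab
    (i2.add ((i3.sub i1).const_mul (q * v ^ (q - 1)))) i4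
    fun t ht => tangent_trunc_le hq hψ hp hv ⟨by linarith [ht.1], by linarith [ht.2]⟩
  rw [intervalIntegral.integral_add i2 ((i3.sub i1).const_mul _),
    intervalIntegral.integral_const_mul, intervalIntegral.integral_sub i3 i1] at h
  have : 0 ≤ q * v ^ (q - 1) * ((∫ t in a..b, ψ t) - ∫ t in a..b, trunc p v t) :=
    mul_nonneg (mul_nonneg (by linarith) (Real.rpow_nonneg hv _)) (by linarith)
  linarith

/-- The strict form: where the profile exceeds the height `v`, the tangent inequality is strict, and
this happens on a whole interval. -/
theorem integral_trunc_rpow_lt (hq : 1 < q) (hqp : q < p) {ψ : ℝ → ℝ} (hψ : IsProfile p ψ)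
    {a b d v : ℝ} (ha : 0 ≤ a) (had : a < d) (hdb : d ≤ b) (hb : b ≤ 1) (hv : 0 ≤ v)
    (hle : ∫ t in a..b, trunc p v t ≤ ∫ t in a..b, ψ t) (hlt : ∀ t ∈ Ioo a d, v < ψ t) :
    ∫ t in a..b, trunc p v t ^ q < ∫ t in a..b, ψ t ^ q := by
  have hp : 1 < p := by linarith
  have hab : a < b := had.trans_le hdb
  have hT := isProfile_trunc hp hv
  have i1 := hT.intervalIntegrable hp ha hab.le hb
  have i2 := hT.intervalIntegrable_rpow hq hqp ha hab.le hb
  have i3 := hψ.intervalIntegrable hp ha hab.le hb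
  have i4 := hψ.intervalIntegrable_rpow hq hqp ha hab.le hb
  have h := intervalIntegral.integral_lt_integral_of_ae_le_of_measure_setOfPred_lt_ne_zero hab.le
    (i2.add ((i3.sub i1).const_mul (q * v ^ (q - 1)))) i4 (by
      filter_upwards [ae_restrict_mem measurableSet_Ioc] with t ht
      exact tangent_trunc_le hq hψ hp hv ⟨by linarith [ht.1], by linarith [ht.2]⟩) (by
      refine (lt_of_lt_of_le ?_ (measure_mono (s := Ioo a d) ?_)).ne'
      · rw [Measure.restrict_apply measurableSet_Ioo,
          inter_eq_left.2 ((Ioo_subset_Ioo_right hdb).trans Ioo_subset_Ioc_self)]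
        simpa using had
      · intro t ht
        have ht' : t ∈ Ioc (0 : ℝ) 1 := ⟨by linarith [ht.1], by linarith [ht.2]⟩
        have hvt := hlt t ht
        have e : trunc p v t = v := min_eq_left (hvt.le.trans (hψ.le_envelope t ht'))
        show trunc p v t ^ q + q * v ^ (q - 1) * (ψ t - trunc p v t) < ψ t ^ q
        rw [e]
        exact tangent_lt_rpow hq (hψ.nonneg t ht') hv hvt.ne')
  rw [intervalIntegral.integral_add i2 ((i3.sub i1).const_mul _),
    intervalIntegral.integral_const_mul, intervalIntegral.integral_sub i3 i1] at h
  have : 0 ≤ q * v ^ (q - 1) * ((∫ t in a..b, ψ t) - ∫ t in a..b, trunc p v t) :=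
    mul_nonneg (mul_nonneg (by linarith) (Real.rpow_nonneg hv _)) (by linarith)
  linarith

/-- A profile with the mass of the envelope has the `q`-th moment of the envelope. -/
theorem IsProfile.integral_rpow_eq_of_integral_eq (hq : 1 < q) (hqp : q < p) {ψ : ℝ → ℝ}
    (hψ : IsProfile p ψ) {a b : ℝ} (ha : 0 ≤ a) (hab : a ≤ b) (hb : b ≤ 1)
    (h : ∫ t in a..b, ψ t = b ^ (1 - 1 / p) - a ^ (1 - 1 / p)) :
    ∫ t in a..b, ψ t ^ q = Gam p q * (b ^ (1 - q / p) - a ^ (1 - q / p)) := by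
  have hp : 1 < p := by linarith
  rw [← integral_envelope hp, intervalIntegral.integral_of_le hab,
    intervalIntegral.integral_of_le hab] at h
  have i3 := (hψ.intervalIntegrable hp ha hab hb).1
  have i4 := (intervalIntegrable_envelope hp a b).1
  rw [integral_eq_iff_of_ae_le i3 i4 (by
    filter_upwards [ae_restrict_mem measurableSet_Ioc] with t ht
    exact hψ.le_envelope t ⟨by linarith [ht.1], by linarith [ht.2]⟩)] at h
  rw [← integral_envelope_rpow hq hqp ha (ha.trans hab), intervalIntegral.integral_of_le hab,
    intervalIntegral.integral_of_le hab]
  refine integral_congr_ae ?_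
  filter_upwards [h] with t ht
  rw [ht]

end Envelope

/-! ### The truncation height determined by a prescribed mass, and its continuity. -/

section Height

variable {p q : ℝ}

theorem one_sub_inv_pos (hp : 1 < p) : 0 < 1 - 1 / p := by
  have : 1 / p < 1 := by rw [div_lt_one (by linarith)]; exact hp
  linarith

theorem continuousAt_envelope {a : ℝ} (ha : 0 < a) : ContinuousAt (envelope p) a :=
  (Real.continuousAt_rpow_const a _ (Or.inl ha.ne')).const_mul _

theorem exists_envelope_eq (hp : 1 < p) {v : ℝ} (hv : 0 < v) : ∃ c, 0 < c ∧ envelope p c = v := by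
  have hκ : 0 < (p - 1) / p := div_pos (by linarith) (by linarith)
  refine ⟨(v / ((p - 1) / p)) ^ (-p), Real.rpow_pos_of_pos (div_pos hv hκ) _, ?_⟩
  rw [envelope, ← Real.rpow_mul (div_pos hv hκ).le,
    show -p * -(1 / p) = 1 by field_simp, Real.rpow_one, mul_div_cancel₀ _ hκ.ne']

theorem le_of_envelope_le (hp : 1 < p) {s t : ℝ} (ht : 0 < t)
    (h : envelope p t ≤ envelope p s) : s ≤ t := by
  by_contra! hlt
  exact absurd (envelope_strictAnti hp ht hlt) (not_lt.2 h)

theorem exists_lt_envelope {a b v : ℝ} (ha : 0 < a) (hab : a < b)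
    (hv : v < envelope p a) : ∃ d, a < d ∧ d < b ∧ v < envelope p d := by
  have h1 : ∀ᶠ d in 𝓝[>] a, v < envelope p d :=
    ((continuousAt_envelope ha).eventually_const_lt hv).filter_mono nhdsWithin_le_nhds
  obtain ⟨d, h, hd⟩ := (h1.and (Ioo_mem_nhdsGT hab)).exists
  exact ⟨d, hd.1, hd.2, h⟩

theorem integral_trunc_mono (hp : 1 < p) {a b v w : ℝ} (ha : 0 ≤ a) (hab : a ≤ b) (hb : b ≤ 1)
    (hv : 0 ≤ v) (hvw : v ≤ w) : ∫ t in a..b, trunc p v t ≤ ∫ t in a..b, trunc p w t :=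
  intervalIntegral.integral_mono_on hab
    ((isProfile_trunc hp hv).intervalIntegrable hp ha hab hb)
    ((isProfile_trunc hp (hv.trans hvw)).intervalIntegrable hp ha hab hb)
    fun _ _ => min_le_min_right _ hvw

/-- Strictness needs `v < envelope p a`: above that value the cut no longer meets the envelope on
`[a, b]` and the mass stops growing. This is why heights are confined to `[0, envelope p a]` below.
-/
theorem integral_trunc_lt (hp : 1 < p) {a b v w : ℝ} (ha : 0 < a) (hab : a < b) (hb : b ≤ 1)
    (hv : 0 ≤ v) (hvw : v < w) (hva : v < envelope p a) :
    ∫ t in a..b, trunc p v t < ∫ t in a..b, trunc p w t := by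
  obtain ⟨d, had, hdb, hd⟩ := exists_lt_envelope ha hab hva
  refine intervalIntegral.integral_lt_integral_of_ae_le_of_measure_setOfPred_lt_ne_zero hab.le
    ((isProfile_trunc hp hv).intervalIntegrable hp ha.le hab.le hb)
    ((isProfile_trunc hp (hv.trans hvw.le)).intervalIntegrable hp ha.le hab.le hb)
    (ae_of_all _ fun _ => min_le_min_right _ hvw.le) ?_
  refine (lt_of_lt_of_le ?_ (measure_mono (s := Ioo a d) ?_)).ne'
  · rw [Measure.restrict_apply measurableSet_Ioo,
      inter_eq_left.2 ((Ioo_subset_Ioo_right hdb.le).trans Ioo_subset_Ioc_self)]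
    simpa using had
  · intro t ht
    have h1 : v < envelope p t := hd.trans (envelope_strictAnti hp (ha.trans ht.1) ht.2)
    show min v (envelope p t) < min w (envelope p t)
    rw [min_eq_left h1.le]
    exact lt_min hvw h1

theorem integral_trunc_envelope (hp : 1 < p) {a : ℝ} (ha : 0 < a) (ha1 : a ≤ 1) :
    ∫ t in a..1, trunc p (envelope p a) t = 1 - a ^ (1 - 1 / p) := by
  rw [integral_trunc hp ha.le ha le_rfl ha1 le_rfl]
  simp

theorem continuousOn_integral_trunc_rpow {r b : ℝ} (hr : 0 ≤ r) (hb : 0 < b) {s : Set ℝ}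
    {a v : ℝ → ℝ} (ha : ContinuousOn a s) (hv : ContinuousOn v s) (hab : ∀ x ∈ s, a x ∈ Icc b 1) :
    ContinuousOn (fun x => ∫ t in (a x)..1, trunc p (v x) t ^ r) s := by
  -- Freezing the envelope to the left of `b > 0` removes its singularity at `0` and changes nothing
  -- on the intervals of integration.
  have hk : Continuous fun t : ℝ => envelope p (max t b) := by
    refine continuous_const.mul ((continuous_id.max continuous_const).rpow_const fun t => Or.inl ?_)
    exact (hb.trans_le (le_max_right _ _)).ne'
  have hF : Continuous (Function.uncurry fun (z : ℝ × ℝ) (t : ℝ) =>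
      min z.2 (envelope p (max t b)) ^ r) := by
    refine Continuous.rpow_const ?_ fun _ => Or.inr hr
    exact (continuous_snd.comp continuous_fst).min (hk.comp continuous_snd)
  have hG := intervalIntegral.continuous_parametric_intervalIntegral_of_continuous
    (μ := volume) (a₀ := 1) hF (s := fun z : ℝ × ℝ => z.1) continuous_fst
  have h := (hG.comp_continuousOn (ha.prodMk hv)).neg
  refine h.congr fun x hx => ?_
  rw [intervalIntegral.integral_symm]
  simp only [Function.comp, Pi.neg_apply, neg_inj]
  refine intervalIntegral.integral_congr fun t ht => ?_
  have : b ≤ t := by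
    rw [uIcc_of_ge (hab x hx).2] at ht
    exact (hab x hx).1.trans ht.1
  simp [trunc, max_eq_left this]

theorem exists_height (hp : 1 < p) {a m : ℝ} (ha : 0 < a) (ha1 : a < 1) (hm : 0 ≤ m)
    (hm1 : m ≤ 1 - a ^ (1 - 1 / p)) :
    ∃ v ∈ Icc 0 (envelope p a), ∫ t in a..1, trunc p v t = m := by
  have hc := continuousOn_integral_trunc_rpow (p := p) zero_le_one ha (s := Icc 0 (envelope p a))
    (continuousOn_const (c := a)) continuousOn_id (fun _ _ => ⟨le_rfl, ha1.le⟩)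
  simp only [Real.rpow_one, id] at hc
  refine intermediate_value_Icc (envelope_nonneg hp ha.le) hc ⟨?_, ?_⟩
  · rw [integral_trunc_of_le hp ha.le ha1.le (envelope_nonneg hp zero_le_one)]
    simpa using hm
  · rw [integral_trunc_envelope hp ha ha1.le]
    exact hm1

theorem lt_of_integral_trunc_lt (hp : 1 < p) {a b v w : ℝ} (ha : 0 ≤ a) (hab : a ≤ b) (hb : b ≤ 1)
    (hw : 0 ≤ w) (h : ∫ t in a..b, trunc p v t < ∫ t in a..b, trunc p w t) : v < w := by
  by_contra! hle
  exact absurd (integral_trunc_mono hp ha hab hb hw hle) (not_le.2 h)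

/-- The height of the truncation of prescribed mass depends continuously on the data. -/
theorem continuousOn_height (hp : 1 < p) {b : ℝ} (hb : 0 < b) {s : Set ℝ} {a m v : ℝ → ℝ}
    (ha : ContinuousOn a s) (hm : ContinuousOn m s) (hab : ∀ x ∈ s, a x ∈ Ico b 1)
    (hv : ∀ x ∈ s, v x ∈ Icc 0 (envelope p (a x)) ∧ ∫ t in (a x)..1, trunc p (v x) t = m x) :
    ContinuousOn v s := by
  have hΦ : ∀ w, ContinuousOn (fun x => ∫ t in (a x)..1, trunc p w t) s := by
    intro w
    have := continuousOn_integral_trunc_rpow (p := p) zero_le_one hb ha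
      (continuousOn_const (c := w)) (fun x hx => Ico_subset_Icc_self (hab x hx))
    simpa only [Real.rpow_one] using this
  intro x hx
  have hax := hb.trans_le (hab x hx).1
  refine tendsto_order.2 ⟨fun w hw => ?_, fun w hw => ?_⟩
  · rcases lt_or_ge w 0 with h0 | h0
    · filter_upwards [self_mem_nhdsWithin] with y hy using h0.trans_le (hv y hy).1.1
    · have h1 := integral_trunc_lt hp hax (hab x hx).2 le_rfl h0 hw (hw.trans_le (hv x hx).1.2)
      rw [(hv x hx).2] at h1
      filter_upwards [(hΦ w x hx).eventually_lt (hm x hx) h1, self_mem_nhdsWithin] with y h2 hy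
      rw [← (hv y hy).2] at h2
      exact lt_of_integral_trunc_lt hp (hb.le.trans (hab y hy).1) (hab y hy).2.le le_rfl
        (hv y hy).1.1 h2
  -- For a height below the maximal one, strict monotonicity of the mass in the height decides. At
  -- the maximal height the mass no longer detects an increase, and the continuous upper bound
  -- `envelope p (a y)` on the heights is used instead.
  · have hw0 : 0 ≤ w := (hv x hx).1.1.trans hw.le
    rcases (hv x hx).1.2.lt_or_eq with h | h
    · have h1 := integral_trunc_lt hp hax (hab x hx).2 le_rfl (hv x hx).1.1 hw h
      rw [(hv x hx).2] at h1
      filter_upwards [(hm x hx).eventually_lt (hΦ w x hx) h1, self_mem_nhdsWithin] with y h2 hy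
      rw [← (hv y hy).2] at h2
      exact lt_of_integral_trunc_lt hp (hb.le.trans (hab y hy).1) (hab y hy).2.le le_rfl hw0 h2
    · rw [h] at hw
      have h1 : Tendsto (fun y => envelope p (a y)) (𝓝[s] x) (𝓝 (envelope p (a x))) :=
        (continuousAt_envelope hax).tendsto.comp (ha x hx)
      filter_upwards [h1.eventually_lt_const hw, self_mem_nhdsWithin] with y h2 hy
      exact (hv y hy).1.2.trans_lt h2

end Height

/-! ### The closed formulas `cSol`, `Ffun`, `Tfun` and `Amin` as moments of truncations. -/

section Formulas

variable {p q : ℝ}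

theorem envelope_mul_self {c : ℝ} (hc : 0 < c) :
    envelope p c * c = (p - 1) / p * c ^ (1 - 1 / p) := by
  rw [envelope, mul_assoc, ← Real.rpow_add_one hc.ne', show -(1 / p) + 1 = 1 - 1 / p by ring]

theorem envelope_rpow_mul_self (hp : 1 < p) {c : ℝ} (hc : 0 < c) :
    envelope p c ^ q * c = ((p - 1) / p) ^ q * c ^ (1 - q / p) := by
  rw [envelope_rpow hp hc.le, mul_assoc, ← Real.rpow_add_one hc.ne',
    show -(q / p) + 1 = 1 - q / p by ring]

theorem cSol_eq (hp : 1 < p) {a c m : ℝ} (ha : 0 < a) (hac : a ≤ c) (hc : c ≤ 1) (ha1 : a < 1)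
    (h : ∫ t in a..1, trunc p (envelope p c) t = m) : cSol p a m = c := by
  -- The equation for `c` states that the truncation at height `envelope p c` has mass `m` on `[a,
  -- 1]`; uniqueness is then strict monotonicity of the mass in the height.
  have key : ∀ d, a ≤ d → d ≤ 1 →
      ((1 / p) * d ^ (1 - 1 / p) + (1 - 1 / p) * a * d ^ (-(1 / p)) = 1 - m ↔
        ∫ t in a..1, trunc p (envelope p d) t = m) := by
    intro d had hd
    have hd0 := ha.trans_le had
    rw [integral_trunc hp ha.le hd0 had hd le_rfl, mul_sub, envelope_mul_self hd0, envelope,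
      Real.one_rpow, show (1 - 1 / p) * a * d ^ (-(1 / p)) = (p - 1) / p * d ^ (-(1 / p)) * a by
        field_simp]
    have e : 1 / p * d ^ (1 - 1 / p) = d ^ (1 - 1 / p) - (p - 1) / p * d ^ (1 - 1 / p) := by
      field_simp; ring
    rw [e]
    constructor <;> intro h <;> linarith
  have hset : {d : ℝ | a ≤ d ∧ d ≤ 1 ∧
      (1 / p) * d ^ (1 - 1 / p) + (1 - 1 / p) * a * d ^ (-(1 / p)) = 1 - m} = {c} := by
    ext d
    simp only [mem_ofPred_eq, mem_singleton_iff]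
    constructor
    · rintro ⟨h1, h2, h3⟩
      rw [key d h1 h2, ← h] at h3
      rcases lt_trichotomy d c with hlt | heq | hlt
      · have h4 := envelope_strictAnti hp (ha.trans_le h1) hlt
        exact absurd h3 (integral_trunc_lt hp ha ha1 le_rfl (envelope_nonneg hp (ha.le.trans hac)) h4
          (h4.trans_le (envelope_anti hp ha h1))).ne'
      · exact heq
      · have h4 := envelope_strictAnti hp (ha.trans_le hac) hlt
        exact absurd h3 (integral_trunc_lt hp ha ha1 le_rfl (envelope_nonneg hp (ha.le.trans h1)) h4
          (h4.trans_le (envelope_anti hp ha hac))).ne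
    · rintro rfl
      exact ⟨hac, hc, (key d hac hc).2 h⟩
  rw [cSol, hset, csInf_singleton]

/-- The case distinction in `Ffun` asks whether the tail mass is at most `κ (1 - a)`, that is,
whether the truncation is constant on `[a, 1]` or meets the envelope at a point `c < 1`. -/
theorem Ffun_eq (hq : 1 < q) (hqp : q < p) {f l a v : ℝ} (hf : f < l) (ha : 0 < a) (ha1 : a < 1)
    (hv : v ∈ Icc 0 (envelope p a)) (h : ∫ t in a..1, trunc p v t = f - l * a) :
    Ffun p q f l a = ∫ t in a..1, trunc p v t ^ q := by
  have hp : 1 < p := by linarith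
  have hκ1 : ∫ t in a..1, trunc p ((p - 1) / p) t = (p - 1) / p * (1 - a) :=
    integral_trunc_of_le hp ha.le ha1.le envelope_one.ge
  have hκ0 : 0 ≤ (p - 1) / p := div_nonneg (by linarith) (by linarith)
  have hκa : (p - 1) / p < envelope p a := by
    rw [← envelope_one (p := p)]; exact envelope_strictAnti hp ha ha1
  have hconst : f - l * a ≤ (p - 1) / p * (1 - a) →
      (f - l * a) ^ q / (1 - a) ^ (q - 1) = ∫ t in a..1, trunc p v t ^ q := by
    intro hle
    have hvκ : v ≤ envelope p 1 := by
      rw [envelope_one]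
      by_contra! hlt
      have := integral_trunc_lt hp ha ha1 le_rfl hκ0 hlt hκa
      linarith
    rw [integral_trunc_rpow_of_le hp ha.le ha1.le hvκ, ← h,
      integral_trunc_of_le hp ha.le ha1.le hvκ]
    have h1a : 0 < 1 - a := by linarith
    rw [Real.mul_rpow hv.1 h1a.le, Real.rpow_sub_one h1a.ne']
    have := Real.rpow_pos_of_pos h1a q
    field_simp
  unfold Ffun
  split_ifs with h1 h2
  · refine hconst ?_
    nlinarith
  · refine hconst ?_
    rw [div_le_iff₀ (by linarith)] at h2
    linarith
  · have hlt : (p - 1) / p * (1 - a) < f - l * a := by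
      rw [not_le, lt_div_iff₀ (by linarith)] at h2
      linarith
    have hvκ : (p - 1) / p < v := by
      refine lt_of_integral_trunc_lt hp ha.le ha1.le le_rfl hv.1 ?_
      rwa [hκ1, h]
    obtain ⟨c, hc0, rfl⟩ := exists_envelope_eq hp (hκ0.trans_lt hvκ)
    have hac : a ≤ c := le_of_envelope_le hp hc0 hv.2
    have hc1 : c ≤ 1 := by
      rw [← envelope_one (p := p)] at hvκ
      exact le_of_envelope_le hp one_pos hvκ.le
    rw [GamFun, cSol_eq hp ha hac hc1 ha1 h, integral_trunc_rpow hq hqp ha.le hc0 hac hc1 le_rfl,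
      envelope_rpow hp hc0.le, Real.one_rpow]

theorem rpow_mul_exponent (hp : 1 < p) {c : ℝ} (hc : 0 ≤ c) :
    (c ^ (1 - 1 / p)) ^ ((p - q) / (p - 1)) = c ^ (1 - q / p) := by
  rw [← Real.rpow_mul hc]
  congr 1
  have : p - 1 ≠ 0 := by linarith
  field_simp

theorem exists_rpow_eq (hp : 1 < p) {m : ℝ} (hm : 0 ≤ m) : ∃ c, 0 ≤ c ∧ c ^ (1 - 1 / p) = m :=
  ⟨m ^ (1 - 1 / p)⁻¹, Real.rpow_nonneg hm _, Real.rpow_inv_rpow hm (one_sub_inv_pos hp).ne'⟩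

/-- The inequality in `hla` is strict because at `l * a = a ^ (1 - 1/p)` the extremal profile is the
untruncated envelope, which has no finite height. -/
theorem exists_Tfun_eq (hq : 1 < q) (hqp : q < p) {l a : ℝ} (hl : 0 < l) (ha : 0 < a)
    (ha1 : a ≤ 1) (hla : l * a < a ^ (1 - 1 / p)) :
    ∃ v, 0 ≤ v ∧ ∫ t in (0 : ℝ)..a, trunc p v t = l * a ∧
      Tfun p q l a = ∫ t in (0 : ℝ)..a, trunc p v t ^ q := by
  have hp : 1 < p := by linarith
  have hκ : 0 < (p - 1) / p := div_pos (by linarith) (by linarith)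
  have hiff : a ≤ (((p - 1) / p) / l) ^ p ↔ l ≤ envelope p a := by
    rw [← Real.rpow_inv_le_iff_of_pos ha.le (by positivity) (by linarith), le_div_iff₀ hl,
      ← le_div_iff₀' (Real.rpow_pos_of_pos ha _), envelope, Real.rpow_neg ha.le, div_eq_mul_inv,
      one_div]
  unfold Tfun
  split_ifs with h
  · refine ⟨l, hl.le, ?_, ?_⟩
    · rw [integral_trunc_of_le hp le_rfl ha.le (hiff.1 h), sub_zero]
    · rw [integral_trunc_rpow_of_le hp le_rfl ha.le (hiff.1 h), sub_zero]
  · rw [hiff, not_le] at h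
    have hpos : 0 < p * (a ^ (1 - 1 / p) - l * a) := mul_pos (by linarith) (by linarith)
    -- The truncation that meets the envelope at `c` has mass `a ^ (1 - 1/p) - c ^ (1 - 1/p) / p` on
    -- `(0, a]`; setting this equal to `l * a` gives `c`.
    obtain ⟨c, hc, hcm⟩ := exists_rpow_eq hp hpos.le
    have hc0 : 0 < c := by
      refine hc.lt_of_ne fun h0 => ?_
      rw [← h0, Real.zero_rpow (one_sub_inv_pos hp).ne'] at hcm
      linarith
    have hca : c ≤ a := by
      rw [← Real.rpow_le_rpow_iff hc ha.le (one_sub_inv_pos hp), hcm]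
      have h1 := mul_lt_mul_of_pos_right h ha
      rw [envelope_mul_self ha, div_mul_eq_mul_div, div_lt_iff₀ (by linarith)] at h1
      linarith
    refine ⟨envelope p c, envelope_nonneg hp hc, ?_, ?_⟩
    · rw [integral_trunc hp le_rfl hc0 hc hca ha1, sub_zero, envelope_mul_self hc0, hcm]
      field_simp
      ring
    · rw [integral_trunc_rpow hq hqp le_rfl hc0 hc hca ha1, sub_zero,
        envelope_rpow_mul_self hp hc0, ← hcm, rpow_mul_exponent hp hc, Gam]
      have : p - q ≠ 0 := by linarith
      field_simp
      ring

theorem Amin_eq_Tfun (f : ℝ) (hp : 1 < p) (hf : 0 < f) : Amin p q f = Tfun p q f 1 := by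
  have hκ : 0 < (p - 1) / p := div_pos (by linarith) (by linarith)
  have : 1 ≤ (((p - 1) / p) / f) ^ p ↔ f ≤ (p - 1) / p := by
    rw [← Real.rpow_inv_le_iff_of_pos zero_le_one (div_pos hκ hf).le (by linarith),
      Real.one_rpow, le_div_iff₀ hf, one_mul]
  simp only [Amin, Tfun, this, Real.one_rpow, mul_one]

/-- The envelope up to `c`, then zero. -/
def cutoff (p c t : ℝ) : ℝ := if t ≤ c then envelope p t else 0

theorem isProfile_cutoff (hp : 1 < p) (c : ℝ) : IsProfile p (cutoff p c) where
  measurable := Measurable.ite measurableSet_Iic measurable_envelope measurable_const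
  nonneg t ht := by
    unfold cutoff; split_ifs
    · exact envelope_nonneg hp ht.1.le
    · rfl
  le_envelope t ht := by
    unfold cutoff; split_ifs
    · rfl
    · exact envelope_nonneg hp ht.1.le

/-- `ψ₁` up to `b`, then `ψ₂`. -/
def glue (b : ℝ) (ψ₁ ψ₂ : ℝ → ℝ) (t : ℝ) : ℝ := if t ≤ b then ψ₁ t else ψ₂ t

theorem IsProfile.glue {ψ₁ ψ₂ : ℝ → ℝ} (h₁ : IsProfile p ψ₁) (h₂ : IsProfile p ψ₂) (b : ℝ) :
    IsProfile p (glue b ψ₁ ψ₂) where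
  measurable := Measurable.ite measurableSet_Iic h₁.measurable h₂.measurable
  nonneg t ht := by
    unfold DyadicWeakType.glue; split_ifs
    · exact h₁.nonneg t ht
    · exact h₂.nonneg t ht
  le_envelope t ht := by
    unfold DyadicWeakType.glue; split_ifs
    · exact h₁.le_envelope t ht
    · exact h₂.le_envelope t ht

/-- The function `g` allows one statement to serve both masses (`g = id`) and moments (`g = (· ^
q)`). -/
theorem integral_glue_left {ψ₁ ψ₂ : ℝ → ℝ} (g : ℝ → ℝ) {a b c : ℝ} (hab : a ≤ b) (hbc : b ≤ c) :
    ∫ t in a..b, g (glue c ψ₁ ψ₂ t) = ∫ t in a..b, g (ψ₁ t) :=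
  intervalIntegral.integral_congr_Ioo_of_le hab fun t ht => by
    simp [glue, ht.2.le.trans hbc]

theorem integral_glue_right {ψ₁ ψ₂ : ℝ → ℝ} (g : ℝ → ℝ) {a b c : ℝ} (hab : a ≤ b) (hca : c ≤ a) :
    ∫ t in a..b, g (glue c ψ₁ ψ₂ t) = ∫ t in a..b, g (ψ₂ t) :=
  intervalIntegral.integral_congr_Ioo_of_le hab fun t ht => by
    simp [glue, (hca.trans_lt ht.1).not_ge]

theorem cutoff_eq_glue (p c : ℝ) : cutoff p c = glue c (envelope p) 0 := rfl

theorem integral_cutoff (hp : 1 < p) {a b c : ℝ} (ha : 0 ≤ a) (hac : a ≤ c) (hcb : c ≤ b)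
    (hb : b ≤ 1) : ∫ t in a..b, cutoff p c t = c ^ (1 - 1 / p) - a ^ (1 - 1 / p) := by
  have hprof := isProfile_cutoff hp c
  rw [← intervalIntegral.integral_add_adjacent_intervals
    (hprof.intervalIntegrable hp ha hac (hcb.trans hb))
    (hprof.intervalIntegrable hp (ha.trans hac) hcb hb), cutoff_eq_glue,
    integral_glue_left (fun x => x) hac le_rfl, integral_glue_right (fun x => x) hcb le_rfl,
    integral_envelope hp]
  simp

theorem integral_cutoff_rpow (hq : 1 < q) (hqp : q < p) {a b c : ℝ} (ha : 0 ≤ a) (hac : a ≤ c)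
    (hcb : c ≤ b) (hb : b ≤ 1) :
    ∫ t in a..b, cutoff p c t ^ q = Gam p q * (c ^ (1 - q / p) - a ^ (1 - q / p)) := by
  have hp : 1 < p := by linarith
  have hprof := isProfile_cutoff hp c
  rw [← intervalIntegral.integral_add_adjacent_intervals
    (hprof.intervalIntegrable_rpow hq hqp ha hac (hcb.trans hb))
    (hprof.intervalIntegrable_rpow hq hqp (ha.trans hac) hcb hb), cutoff_eq_glue,
    integral_glue_left (fun x => x ^ q) hac le_rfl, integral_glue_right (fun x => x ^ q) hcb le_rfl,
    integral_envelope_rpow hq hqp ha (ha.trans hac)]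
  simp [Real.zero_rpow (by linarith : q ≠ 0)]

end Formulas

/-! ### The equation for `λ₁`: existence, uniqueness and monotonicity. -/

section Root

variable {p q : ℝ}

theorem mul_le_rpow_iff (hp : 1 < p) {l a : ℝ} (hl : 0 < l) (ha : 0 < a) :
    l * a ≤ a ^ (1 - 1 / p) ↔ a ≤ 1 / l ^ p := by
  rw [show (1 : ℝ) - 1 / p = -p⁻¹ + 1 by ring, Real.rpow_add_one ha.ne',
    mul_le_mul_iff_of_pos_right ha, Real.rpow_neg ha.le, ← Real.inv_rpow ha.le,
    Real.le_rpow_inv_iff_of_pos hl.le (by positivity) (by linarith),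
    le_inv_comm₀ (by positivity) ha, one_div]

theorem mul_lt_rpow_iff (hp : 1 < p) {l a : ℝ} (hl : 0 < l) (ha : 0 < a) :
    l * a < a ^ (1 - 1 / p) ↔ a < 1 / l ^ p := by
  rw [show (1 : ℝ) - 1 / p = -p⁻¹ + 1 by ring, Real.rpow_add_one ha.ne',
    mul_lt_mul_iff_of_pos_right ha, Real.rpow_neg ha.le, ← Real.inv_rpow ha.le,
    Real.lt_rpow_inv_iff_of_pos hl.le (by positivity) (by linarith),
    lt_inv_comm₀ (by positivity) ha, one_div]

theorem rpow_one_div_rpow (hp : 1 < p) {l : ℝ} (hl : 0 < l) :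
    (1 / l ^ p) ^ (1 - 1 / p) = l * (1 / l ^ p) := by
  rw [one_div (l ^ p), ← Real.rpow_neg hl.le, ← Real.rpow_mul hl.le,
    ← Real.rpow_one_add' hl.le (by linarith)]
  congr 1
  field_simp
  ring

theorem rpow_one_div_rpow' (hp : 1 < p) {l : ℝ} (hl : 0 < l) :
    (1 / l ^ p) ^ (1 - q / p) = 1 / l ^ (p - q) := by
  rw [one_div (l ^ p), ← Real.rpow_neg hl.le, ← Real.rpow_mul hl.le, one_div,
    ← Real.rpow_neg hl.le]
  congr 1
  field_simp

theorem threshold_le_iff (hp : 1 < p) {f l : ℝ} (hf : 0 < f) (hl : 0 < l) :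
    (1 / f) ^ (1 / (p - 1)) ≤ l ↔ 1 / l ^ p ≤ f / l := by
  rw [one_div (p - 1), Real.rpow_inv_le_iff_of_pos (by positivity) hl.le (by linarith),
    Real.rpow_sub_one hl.ne']
  have : 0 < l ^ p := Real.rpow_pos_of_pos hl p
  rw [div_le_div_iff₀ hf hl, div_le_div_iff₀ this hl, one_mul, mul_comm]

theorem one_lt_threshold (hp : 1 < p) {f : ℝ} (hf : 0 < f) (hf1 : f < 1) :
    1 < (1 / f) ^ (1 / (p - 1)) :=
  Real.one_lt_rpow ((one_lt_div hf).2 hf1) (div_pos one_pos (by linarith))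

theorem Amin_one (hq : 1 < q) (hqp : q < p) : Amin p q 1 = Gam p q := by
  have hp : 1 < p := by linarith
  have h1 : ¬ (1 : ℝ) ≤ (p - 1) / p := by
    rw [not_le, div_lt_one (by linarith)]; linarith
  have h2 : (p - q) / (p - 1) ≠ 0 := (div_pos (by linarith) (by linarith)).ne'
  rw [Amin, if_neg h1, Gam, sub_self, mul_zero, Real.zero_rpow h2]
  ring

/-- The values of the left side of the equation that determines `λ₁`. -/
def rootFun (p q f l : ℝ) : ℝ := Ffun p q f l (1 / l ^ p) + Gam p q / l ^ (p - q)

/-- Identifies the left side of the equation as the moment of the profile that is the envelope on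
`(0, l ^ (-p)]` and the minimal truncation afterwards. -/
theorem exists_rootFun_eq (hq : 1 < q) (hqp : q < p) {f l : ℝ} (hf : 0 < f) (hf1 : f < 1)
    (hl : (1 / f) ^ (1 / (p - 1)) ≤ l) :
    ∃ v ∈ Icc 0 (envelope p (1 / l ^ p)),
      ∫ t in (1 / l ^ p)..1, trunc p v t = f - l * (1 / l ^ p) ∧
      rootFun p q f l =
        (∫ t in (1 / l ^ p)..1, trunc p v t ^ q) + Gam p q * (1 / l ^ p) ^ (1 - q / p) := by
  have hp : 1 < p := by linarith
  have hl1 : 1 < l := (one_lt_threshold hp hf hf1).trans_le hl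
  have hl0 : 0 < l := by linarith
  have hlp : 0 < l ^ p := Real.rpow_pos_of_pos hl0 p
  have hb1 : 1 / l ^ p < 1 := by
    rw [div_lt_one hlp]; exact Real.one_lt_rpow hl1 (by linarith)
  have hle := (threshold_le_iff hp hf hl0).1 hl
  rw [le_div_iff₀ hl0, mul_comm] at hle
  obtain ⟨v, hv, hm⟩ := exists_height hp (by positivity) hb1 (m := f - l * (1 / l ^ p))
    (by linarith) (by rw [rpow_one_div_rpow hp hl0]; linarith)
  refine ⟨v, hv, hm, ?_⟩
  rw [rootFun, Ffun_eq hq hqp (by linarith) (by positivity) hb1 hv hm, rpow_one_div_rpow' hp hl0]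
  ring

/-- At the left endpoint the envelope on `(0, l ^ (-p)]` already carries the whole mass `f`, so the
tail is zero. -/
theorem rootFun_threshold (hq : 1 < q) (hqp : q < p) {f : ℝ} (hf : 0 < f) (hf1 : f < 1) :
    rootFun p q f ((1 / f) ^ (1 / (p - 1))) = Gam p q * f ^ ((p - q) / (p - 1)) := by
  have hp : 1 < p := by linarith
  have hl1 := one_lt_threshold hp hf hf1
  set l := (1 / f) ^ (1 / (p - 1)) with hl
  have hl0 : 0 < l := by linarith
  have hlp : 0 < l ^ p := Real.rpow_pos_of_pos hl0 p
  obtain ⟨v, hv, hm, he⟩ := exists_rootFun_eq hq hqp hf hf1 hl.ge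
  have hb1 : 1 / l ^ p < 1 := by
    rw [div_lt_one hlp]; exact Real.one_lt_rpow hl1 (by linarith)
  have hf' : l * (1 / l ^ p) = f := by
    have h1 : l ^ (p - 1) = 1 / f := by
      rw [hl, ← Real.rpow_mul (by positivity), one_div_mul_cancel (by linarith), Real.rpow_one]
    rw [Real.rpow_sub_one hl0.ne'] at h1
    field_simp at h1 ⊢
    linarith
  have hv0 : v = 0 := by
    by_contra hne
    have := integral_trunc_lt hp (by positivity) hb1 le_rfl le_rfl (hv.1.lt_of_ne' hne)
      (envelope_pos hp (by positivity))
    rw [hm, hf', integral_trunc_of_le hp (by positivity) hb1.le (envelope_nonneg hp zero_le_one)]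
      at this
    linarith
  rw [he, hv0, integral_trunc_rpow_of_le hp (by positivity) hb1.le
    (envelope_nonneg hp zero_le_one), Real.zero_rpow (by linarith),
    ← rpow_mul_exponent hp (by positivity), rpow_one_div_rpow hp hl0, hf']
  ring

/-- For `l < l'` the profile belonging to `l`, seen on `(l' ^ (-p), 1]`, is a competitor for the
tail belonging to `l'` with the same mass. It follows the envelope just after `l' ^ (-p)`, above the
height of the optimal truncation, so it is strictly worse. -/
theorem rootFun_strictAnti (hq : 1 < q) (hqp : q < p) {f : ℝ} (hf : 0 < f) (hf1 : f < 1) :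
    StrictAntiOn (rootFun p q f) (Ici ((1 / f) ^ (1 / (p - 1)))) := by
  intro l hl l' hl' hll
  have hp : 1 < p := by linarith
  have hl1 : 1 < l := (one_lt_threshold hp hf hf1).trans_le hl
  have hl0 : 0 < l := by linarith
  have hl0' : 0 < l' := by linarith
  obtain ⟨v, hv, hm, he⟩ := exists_rootFun_eq hq hqp hf hf1 hl
  obtain ⟨v', hv', hm', he'⟩ := exists_rootFun_eq hq hqp hf hf1 hl'
  rw [he, he']
  rw [← rpow_one_div_rpow hp hl0] at hm
  rw [← rpow_one_div_rpow hp hl0'] at hm'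
  have hlp : 0 < l ^ p := Real.rpow_pos_of_pos hl0 p
  have hlp' : 0 < l' ^ p := Real.rpow_pos_of_pos hl0' p
  have hb1 : 1 / l ^ p < 1 := by
    rw [div_lt_one hlp]; exact Real.one_lt_rpow hl1 (by linarith)
  have hbb : 1 / l' ^ p < 1 / l ^ p :=
    one_div_lt_one_div_of_lt hlp (Real.rpow_lt_rpow hl0.le hll (by linarith))
  have hb0 : 0 < 1 / l' ^ p := by positivity
  clear he he'
  generalize 1 / l ^ p = b at *
  generalize 1 / l' ^ p = b' at *
  -- At the maximal height the tail would be the full envelope and the total mass would be `1`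
  -- rather than `f`.
  have hvlt : v' < envelope p b' := by
    refine hv'.2.lt_of_ne fun h => ?_
    rw [h, integral_trunc_envelope hp hb0 (hbb.trans hb1).le] at hm'
    linarith
  obtain ⟨d, hd1, hd2, hd⟩ := exists_lt_envelope hb0 hbb hvlt
  have hprof := (isProfile_envelope hp).glue (isProfile_trunc hp hv.1) b
  have i1 := hprof.intervalIntegrable hp hb0.le hbb.le hb1.le
  have i2 := hprof.intervalIntegrable hp (hb0.le.trans hbb.le) hb1.le le_rfl
  have i3 := hprof.intervalIntegrable_rpow hq hqp hb0.le hbb.le hb1.le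
  have i4 := hprof.intervalIntegrable_rpow hq hqp (hb0.le.trans hbb.le) hb1.le le_rfl
  have h := integral_trunc_rpow_lt hq hqp hprof hb0.le hd1 (hd2.trans hb1).le le_rfl hv'.1 (by
    rw [hm', ← intervalIntegral.integral_add_adjacent_intervals i1 i2,
      integral_glue_left (fun x => x) hbb.le le_rfl, integral_glue_right (fun x => x) hb1.le le_rfl,
      integral_envelope hp, hm]
    linarith) (by
    intro t ht
    rw [glue, if_pos (ht.2.trans hd2).le]
    exact hd.trans (envelope_strictAnti hp (hb0.trans ht.1) ht.2))
  rw [← intervalIntegral.integral_add_adjacent_intervals i3 i4,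
    integral_glue_left (fun x => x ^ q) hbb.le le_rfl,
    integral_glue_right (fun x => x ^ q) hb1.le le_rfl,
    integral_envelope_rpow hq hqp hb0.le (hb0.le.trans hbb.le)] at h
  linarith

theorem continuousOn_Ffun (hq : 1 < q) (hqp : q < p) {f b : ℝ} (hb : 0 < b) {s : Set ℝ}
    {l a : ℝ → ℝ} (hl : ContinuousOn l s) (ha : ContinuousOn a s) (hfl : ∀ x ∈ s, f < l x)
    (hab : ∀ x ∈ s, a x ∈ Ico b 1) (h0 : ∀ x ∈ s, l x * a x ≤ f)
    (h1 : ∀ x ∈ s, f - l x * a x ≤ 1 - a x ^ (1 - 1 / p)) :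
    ContinuousOn (fun x => Ffun p q f (l x) (a x)) s := by
  have hp : 1 < p := by linarith
  have hex : ∀ x, ∃ v, x ∈ s → v ∈ Icc 0 (envelope p (a x)) ∧
      ∫ t in (a x)..1, trunc p v t = f - l x * a x := by
    intro x
    by_cases hx : x ∈ s
    · obtain ⟨v, hv⟩ := exists_height hp (hb.trans_le (hab x hx).1) (hab x hx).2
        (sub_nonneg.2 (h0 x hx)) (h1 x hx)
      exact ⟨v, fun _ => hv⟩
    · exact ⟨0, fun h => absurd h hx⟩
  choose v hv using hex
  have hvc := continuousOn_height hp hb ha (continuousOn_const.sub (hl.mul ha)) hab hv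
  refine (continuousOn_integral_trunc_rpow (p := p) (r := q) (by linarith) hb ha hvc
    fun x hx => Ico_subset_Icc_self (hab x hx)).congr fun x hx => ?_
  exact Ffun_eq hq hqp (hfl x hx) (hb.trans_le (hab x hx).1) (hab x hx).2 (hv x hx).1 (hv x hx).2

theorem continuousOn_rootFun (hq : 1 < q) (hqp : q < p) {f : ℝ} (hf : 0 < f) (hf1 : f < 1)
    (L : ℝ) : ContinuousOn (rootFun p q f) (Icc ((1 / f) ^ (1 / (p - 1))) L) := by
  have hp : 1 < p := by linarith
  have hl1 : ∀ l ∈ Icc ((1 / f) ^ (1 / (p - 1))) L, 1 < l := fun l hl =>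
    (one_lt_threshold hp hf hf1).trans_le hl.1
  rcases lt_or_ge L ((1 / f) ^ (1 / (p - 1))) with hL | hL
  · rw [Icc_eq_empty (not_le.2 hL)]
    exact continuousOn_empty _
  have hL1 := hl1 L ⟨hL, le_rfl⟩
  have hpow : ∀ r : ℝ, ContinuousOn (fun l : ℝ => l ^ r) (Icc ((1 / f) ^ (1 / (p - 1))) L) :=
    fun r => continuousOn_id.rpow_const fun l hl => Or.inl (by simp only [id]; linarith [hl1 l hl])
  refine ContinuousOn.add (continuousOn_Ffun hq hqp (b := 1 / L ^ p) (by positivity)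
    continuousOn_id (continuousOn_const.div (hpow p) ?_) ?_ ?_ ?_ ?_)
    (continuousOn_const.div (hpow _) ?_)
  · exact fun l hl => (Real.rpow_pos_of_pos (by linarith [hl1 l hl]) _).ne'
  · exact fun l hl => hf1.trans (hl1 l hl)
  · intro l hl
    have h1 := hl1 l hl
    have hlp : 0 < l ^ p := Real.rpow_pos_of_pos (by linarith) _
    exact ⟨one_div_le_one_div_of_le hlp (Real.rpow_le_rpow (by linarith) hl.2 (by linarith)),
      by rw [div_lt_one hlp]; exact Real.one_lt_rpow h1 (by linarith)⟩
  · intro l hl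
    have h0 : 0 < l := by linarith [hl1 l hl]
    have hle := (threshold_le_iff hp hf h0).1 hl.1
    rwa [le_div_iff₀ h0, mul_comm] at hle
  · intro l hl
    have h0 : 0 < l := by linarith [hl1 l hl]
    rw [rpow_one_div_rpow hp h0]
    linarith
  · exact fun l hl => (Real.rpow_pos_of_pos (by linarith [hl1 l hl]) _).ne'

theorem exists_trunc_eq_Amin (hq : 1 < q) (hqp : q < p) {f : ℝ} (hf : 0 < f) (hf1 : f < 1) :
    ∃ v, 0 ≤ v ∧ ∫ t in (0 : ℝ)..1, trunc p v t = f ∧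
      Amin p q f = ∫ t in (0 : ℝ)..1, trunc p v t ^ q := by
  obtain ⟨v, hv, h1, h2⟩ := exists_Tfun_eq hq hqp hf one_pos le_rfl (by simpa using hf1)
  exact ⟨v, hv, by rw [h1, mul_one], by rw [Amin_eq_Tfun f (by linarith) hf, h2]⟩

/-- The truncation that attains `A_f` has at most the envelope's mass on `(0, b]`, where `b = l ^
(-p)`, hence at least the required tail mass; so the minimal tail moment is at most `A_f`. -/
theorem rootFun_le (hq : 1 < q) (hqp : q < p) {f l : ℝ} (hf : 0 < f) (hf1 : f < 1)
    (hl : (1 / f) ^ (1 / (p - 1)) ≤ l) :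
    rootFun p q f l ≤ Amin p q f + Gam p q / l ^ (p - q) := by
  have hp : 1 < p := by linarith
  have hl1 : 1 < l := (one_lt_threshold hp hf hf1).trans_le hl
  have hl0 : 0 < l := by linarith
  have hlp : 0 < l ^ p := Real.rpow_pos_of_pos hl0 p
  have hb1 : 1 / l ^ p < 1 := by
    rw [div_lt_one hlp]; exact Real.one_lt_rpow hl1 (by linarith)
  have hb0 : 0 < 1 / l ^ p := by positivity
  obtain ⟨v, hv, hm, he⟩ := exists_rootFun_eq hq hqp hf hf1 hl
  obtain ⟨w, hw, hw1, hw2⟩ := exists_trunc_eq_Amin hq hqp hf hf1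
  rw [he, rpow_one_div_rpow' hp hl0, hw2]
  rw [← rpow_one_div_rpow hp hl0] at hm
  generalize 1 / l ^ p = b at *
  have hW := isProfile_trunc hp hw
  rw [← intervalIntegral.integral_add_adjacent_intervals
    (hW.intervalIntegrable hp le_rfl hb0.le hb1.le)
    (hW.intervalIntegrable hp hb0.le hb1.le le_rfl)] at hw1
  rw [← intervalIntegral.integral_add_adjacent_intervals
    (hW.intervalIntegrable_rpow hq hqp le_rfl hb0.le hb1.le)
    (hW.intervalIntegrable_rpow hq hqp hb0.le hb1.le le_rfl)]
  have h1 := hW.integral_le hp le_rfl hb0.le hb1.le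
  rw [Real.zero_rpow (one_sub_inv_pos hp).ne'] at h1
  have h2 := integral_trunc_rpow_le hq hqp hW hb0.le hb1.le le_rfl hv.1 (by linarith)
  have h3 : 0 ≤ ∫ t in (0 : ℝ)..b, trunc p w t ^ q := by
    rw [intervalIntegral.integral_of_le hb0.le]
    exact setIntegral_nonneg measurableSet_Ioc fun t ht => Real.rpow_nonneg (hW.nonneg t ⟨ht.1, ht.2.trans hb1.le⟩) _
  have e : Gam p q * (1 / l ^ (p - q)) = Gam p q / l ^ (p - q) := by ring
  linarith

theorem exists_root (hq : 1 < q) (hqp : q < p) {f A : ℝ} (hf : 0 < f) (hf1 : f < 1)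
    (hA : Amin p q f < A) (hA' : A ≤ Gam p q * f ^ ((p - q) / (p - 1))) :
    ∃ l, (1 / f) ^ (1 / (p - 1)) ≤ l ∧ rootFun p q f l = A := by
  have ht : Tendsto (fun l : ℝ => Amin p q f + Gam p q / l ^ (p - q)) atTop
      (𝓝 (Amin p q f + 0)) :=
    tendsto_const_nhds.add ((tendsto_rpow_atTop (by linarith)).const_div_atTop _)
  rw [add_zero] at ht
  obtain ⟨L, hL, hL0⟩ := ((ht.eventually_lt_const hA).and
    (eventually_ge_atTop ((1 / f) ^ (1 / (p - 1))))).exists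
  obtain ⟨l, hl, h⟩ := intermediate_value_Icc' hL0 (continuousOn_rootFun hq hqp hf hf1 L)
    ⟨(rootFun_le hq hqp hf hf1 hL0).trans hL.le, by rwa [rootFun_threshold hq hqp hf hf1]⟩
  exact ⟨l, hl.1, h⟩

end Root

/-! ### Moving a number to the right until it becomes feasible. -/

section Feasible

variable {p q : ℝ}

/-- The numbers over which the supremum in the formula for `B₁` is taken. -/
def feasible (p q f A l : ℝ) : Set ℝ :=
  {b : ℝ | 0 ≤ b ∧ b ≤ min (f / l) (1 / l ^ p) ∧ f - l * b ≤ 1 - b ^ (1 - 1 / p) ∧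
    Tfun p q l b ≤ A - Ffun p q f l b ∧ A - Ffun p q f l b ≤ Sfun p q l b}

theorem Tfun_le_Sfun (hq : 1 < q) (hqp : q < p) {l a : ℝ} (hl : 0 < l) (ha : 0 < a) (ha1 : a ≤ 1)
    (hla : l * a < a ^ (1 - 1 / p)) : Tfun p q l a ≤ Sfun p q l a := by
  have hp : 1 < p := by linarith
  obtain ⟨v, hv, h1, h2⟩ := exists_Tfun_eq hq hqp hl ha ha1 hla
  obtain ⟨c, hc, hcm⟩ := exists_rpow_eq hp (mul_pos hl ha).le
  have hca : c ≤ a := by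
    rw [← Real.rpow_le_rpow_iff hc ha.le (one_sub_inv_pos hp), hcm]; exact hla.le
  have h := integral_trunc_rpow_le hq hqp (isProfile_cutoff hp c) le_rfl ha.le ha1 hv (by
    rw [h1, integral_cutoff hp le_rfl hc hca ha1, hcm, Real.zero_rpow (one_sub_inv_pos hp).ne',
      sub_zero])
  have hq1 : 1 - q / p ≠ 0 := by
    have : q / p < 1 := by rw [div_lt_one (by linarith)]; exact hqp
    linarith
  rwa [← h2, integral_cutoff_rpow hq hqp le_rfl hc hca ha1, ← rpow_mul_exponent hp hc, hcm,
    Real.zero_rpow hq1, sub_zero] at h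

/-- If `A - F` exceeds `S` at `b`, the intermediate value theorem along the path `[b, e]` finds `a`
with `A = F + S`, and there the remaining condition is just `T ≤ S`. The hypothesis `hroot` encodes
`l < λ₁`. -/
theorem exists_feasible (hq : 1 < q) (hqp : q < p) {f A l b : ℝ} (hf : 0 < f) (hf1 : f < 1)
    (hA' : A ≤ Gam p q * f ^ ((p - q) / (p - 1))) (hl : f < l)
    (hroot : (1 / f) ^ (1 / (p - 1)) ≤ l → A < rootFun p q f l)
    (hb : 0 < b) (hbf : b ≤ f / l) (hbl : b < 1 / l ^ p)
    (hpath : ∀ a, b ≤ a → a ≤ 1 → f - l * a ≤ 1 - a ^ (1 - 1 / p))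
    (hT : Tfun p q l b + Ffun p q f l b ≤ A) :
    ∃ a, b ≤ a ∧ a ∈ feasible p q f A l := by
  have hp : 1 < p := by linarith
  have hl0 : 0 < l := by linarith
  have hfl : f / l < 1 := by rwa [div_lt_one hl0]
  rcases le_or_gt (A - Ffun p q f l b) (Sfun p q l b) with hS | hS
  · exact ⟨b, le_rfl, hb.le, le_min hbf hbl.le, hpath b le_rfl (hbf.trans hfl.le),
      by linarith, hS⟩
  have hcont : ContinuousOn (fun a => Ffun p q f l a + Sfun p q l a) (Icc b (f / l)) := by
    refine (continuousOn_Ffun hq hqp hb continuousOn_const continuousOn_id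
      (fun _ _ => hl) (fun a ha => ⟨ha.1, ha.2.trans_lt hfl⟩) (fun a ha => ?_)
      (fun a ha => hpath a ha.1 (ha.2.trans hfl.le))).add (continuousOn_const.mul
        ((continuousOn_const.mul continuousOn_id).rpow_const fun a ha => Or.inl ?_))
    · rw [mul_comm]; exact (le_div_iff₀ hl0).1 ha.2
    · exact (mul_pos hl0 (hb.trans_le ha.1)).ne'
  -- The right endpoint is the smaller of `f / l` and `l ^ (-p)`. The crossing must avoid `l ^
  -- (-p)`, since the description of `T` by a truncation and hence `T ≤ S` are available only
  -- strictly below it.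
  suffices h : ∃ e, b ≤ e ∧ e ≤ f / l ∧ A ≤ Ffun p q f l e + Sfun p q l e ∧
      ∀ a ≤ e, A = Ffun p q f l a + Sfun p q l a → a < 1 / l ^ p by
    obtain ⟨e, hbe, hef, hAe, hlast⟩ := h
    obtain ⟨a, ha, hAa⟩ := intermediate_value_Icc hbe
      (hcont.mono (Icc_subset_Icc_right hef)) ⟨by linarith, hAe⟩
    have ha0 := hb.trans_le ha.1
    have hal := hlast a ha.2 hAa.symm
    have ha1 : a ≤ 1 := (ha.2.trans hef).trans hfl.le
    have := Tfun_le_Sfun hq hqp hl0 ha0 ha1 ((mul_lt_rpow_iff hp hl0 ha0).2 hal)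
    simp only at hAa
    exact ⟨a, ha.1, ha0.le, le_min (ha.2.trans hef) hal.le, hpath a ha.1 ha1, by linarith,
      by linarith⟩
  rcases le_or_gt ((1 / f) ^ (1 / (p - 1))) l with hle | hlt
  · have hS' : Ffun p q f l (1 / l ^ p) + Sfun p q l (1 / l ^ p) = rootFun p q f l := by
      rw [rootFun, Sfun, ← rpow_one_div_rpow hp hl0, rpow_mul_exponent hp (by positivity),
        rpow_one_div_rpow' hp hl0]
      ring
    have hr := hroot hle
    refine ⟨1 / l ^ p, hbl.le, (threshold_le_iff hp hf hl0).1 hle, by linarith, ?_⟩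
    intro a ha hAa
    refine ha.lt_of_ne fun h => ?_
    rw [h, hS'] at hAa
    linarith
  · have hlt' : f / l < 1 / l ^ p := by
      rw [← not_le, ← threshold_le_iff hp hf hl0]; exact not_le.2 hlt
    refine ⟨f / l, hbf, le_rfl, ?_, fun a ha _ => ha.trans_lt hlt'⟩
    have e : l * (f / l) = f := mul_div_cancel₀ _ hl0.ne'
    -- At `f / l` no mass is left for the tail, so `F + S` is `Γ f ^ r`, which bounds `A`.
    have hF : Ffun p q f l (f / l) = 0 := by
      have h0 : (0 : ℝ) ≤ envelope p 1 := envelope_nonneg hp zero_le_one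
      rw [Ffun_eq hq hqp hl (by positivity) hfl (v := 0)
        ⟨le_rfl, envelope_nonneg hp (by positivity)⟩
        (by rw [integral_trunc_of_le hp (by positivity) hfl.le h0, e]; ring),
        integral_trunc_rpow_of_le hp (by positivity) hfl.le h0, Real.zero_rpow (by linarith),
        zero_mul]
    rw [hF, Sfun, e, zero_add]
    exact hA'

end Feasible

/-! ### Nested structure of the tree and the weak type inequality for the maximal operator. -/

section Tree

theorem mem_treeLevel_succ {X : Type*} {C : Set X → Set (Set X)} {m : ℕ} {J : Set X} :
    J ∈ treeLevel C (m + 1) ↔ ∃ I ∈ treeLevel C m, J ∈ C I := by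
  simp [treeLevel]

variable {X : Type*} [MeasurableSpace X] {μ : Measure X} {T : Set (Set X)}
  {C : Set X → Set (Set X)}

theorem IsTree.level_subset (hT : IsTree μ T C) (m : ℕ) : treeLevel C m ⊆ T := by
  rw [hT.eq_iUnion_level]
  exact subset_iUnion (treeLevel C) m

theorem IsTree.level_countable (hT : IsTree μ T C) (m : ℕ) : (treeLevel C m).Countable := by
  induction m with
  | zero => exact countable_singleton _
  | succ m ih => exact ih.biUnion fun I hI => hT.children_countable I (hT.level_subset m hI)

theorem IsTree.countable (hT : IsTree μ T C) : T.Countable := by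
  rw [hT.eq_iUnion_level]
  exact countable_iUnion hT.level_countable

theorem IsTree.exists_mem_level (hT : IsTree μ T C) (m : ℕ) (x : X) :
    ∃ I ∈ treeLevel C m, x ∈ I := by
  induction m with
  | zero => exact ⟨univ, rfl, mem_univ x⟩
  | succ m ih =>
    obtain ⟨I, hI, hx⟩ := ih
    rw [hT.eq_sUnion_children I (hT.level_subset m hI)] at hx
    obtain ⟨J, hJ, hxJ⟩ := hx
    exact ⟨J, mem_treeLevel_succ.2 ⟨I, hI, hJ⟩, hxJ⟩

theorem IsTree.exists_ancestor (hT : IsTree μ T C) {m n : ℕ} (hmn : m ≤ n) {J : Set X}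
    (hJ : J ∈ treeLevel C n) : ∃ I ∈ treeLevel C m, J ⊆ I := by
  induction n, hmn using Nat.le_induction generalizing J with
  | base => exact ⟨J, hJ, Subset.rfl⟩
  | succ n _ ih =>
    obtain ⟨K, hK, hJK⟩ := mem_treeLevel_succ.1 hJ
    obtain ⟨I, hI, hKI⟩ := ih hK
    exact ⟨I, hI, (hT.subset_of_mem_children K (hT.level_subset n hK) J hJK).trans hKI⟩

theorem IsTree.level_aedisjoint (hT : IsTree μ T C) (m : ℕ) :
    (treeLevel C m).Pairwise (AEDisjoint μ) := by
  induction m with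
  | zero => exact pairwise_singleton _ _
  | succ m ih =>
    intro J hJ J' hJ' hne
    obtain ⟨I, hI, hJI⟩ := mem_treeLevel_succ.1 hJ
    obtain ⟨I', hI', hJI'⟩ := mem_treeLevel_succ.1 hJ'
    have hIT := hT.level_subset m hI
    by_cases h : I = I'
    · subst h
      exact hT.children_aedisjoint I hIT hJI hJI' hne
    · exact (ih hI hI' h).mono (hT.subset_of_mem_children I hIT J hJI)
        (hT.subset_of_mem_children I' (hT.level_subset m hI') J' hJI')

theorem IsTree.subset_or_aedisjoint (hT : IsTree μ T C) {I J : Set X} (hI : I ∈ T) (hJ : J ∈ T) :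
    I ⊆ J ∨ J ⊆ I ∨ AEDisjoint μ I J := by
  rw [hT.eq_iUnion_level, mem_iUnion] at hI hJ
  obtain ⟨m, hm⟩ := hI
  obtain ⟨n, hn⟩ := hJ
  rcases le_total m n with h | h
  · obtain ⟨K, hK, hJK⟩ := hT.exists_ancestor h hn
    by_cases hIK : I = K
    · exact Or.inr (Or.inl (hIK ▸ hJK))
    · exact Or.inr (Or.inr ((hT.level_aedisjoint m hm hK hIK).mono Subset.rfl hJK))
  · obtain ⟨K, hK, hIK⟩ := hT.exists_ancestor h hm
    by_cases hJK : K = J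
    · exact Or.inl (hJK ▸ hIK)
    · exact Or.inr (Or.inr ((hT.level_aedisjoint n hK hn hJK).mono hIK Subset.rfl))

/-- Tree elements are nested or almost disjoint: a pairwise almost disjoint family is summed, and
otherwise an element contained in another one is dropped without changing the union. Absolute
continuity transfers almost disjointness to `ν`. -/
theorem IsTree.mul_measure_biUnion_finset_le (hT : IsTree μ T C) {ν : Measure X} (hν : ν ≪ μ)
    {c : ℝ≥0∞} (S : Finset (Set X)) (hS : ∀ I ∈ S, I ∈ T) (h : ∀ I ∈ S, c * μ I ≤ ν I) :
    c * μ (⋃ I ∈ S, I) ≤ ν (⋃ I ∈ S, I) := by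
  classical
  induction S using Finset.strongInduction with
  | H S ih =>
    by_cases hd : (S : Set (Set X)).Pairwise (AEDisjoint μ)
    · have hm : ∀ I ∈ S, MeasurableSet I := fun I hI => hT.measurableSet I (hS I hI)
      rw [measure_biUnion_finset₀ hd fun I hI => (hm I hI).nullMeasurableSet,
        measure_biUnion_finset₀ (fun I hI J hJ hne => hν (hd hI hJ hne))
          fun I hI => (hm I hI).nullMeasurableSet, Finset.mul_sum]
      exact Finset.sum_le_sum h
    · obtain ⟨I, hI, J, hJ, hne, hIJ⟩ : ∃ I ∈ S, ∃ J ∈ S, I ≠ J ∧ I ⊆ J := by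
        simp only [Set.Pairwise, not_forall] at hd
        obtain ⟨I, hI, J, hJ, hne, hnd⟩ := hd
        rcases hT.subset_or_aedisjoint (hS I hI) (hS J hJ) with h | h | h
        · exact ⟨I, hI, J, hJ, hne, h⟩
        · exact ⟨J, hJ, I, hI, hne.symm, h⟩
        · exact absurd h hnd
      have e : ⋃ K ∈ S, K = ⋃ K ∈ S.erase I, K := by
        refine Subset.antisymm (iUnion₂_subset fun K hK => ?_)
          (biUnion_subset_biUnion_left fun K hK => Finset.mem_of_mem_erase hK)
        by_cases hKI : K = I
        · subst hKI
          exact hIJ.trans (subset_biUnion_of_mem (u := fun K : Set X => K)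
            (Finset.mem_erase.2 ⟨hne.symm, hJ⟩))
        · exact subset_biUnion_of_mem (u := fun K : Set X => K) (Finset.mem_erase.2 ⟨hKI, hK⟩)
      rw [e]
      exact ih _ (Finset.erase_ssubset hI) (fun K hK => hS K (Finset.mem_of_mem_erase hK))
        fun K hK => h K (Finset.mem_of_mem_erase hK)

theorem IsTree.mul_measure_sUnion_le (hT : IsTree μ T C) {ν : Measure X} (hν : ν ≪ μ)
    {c : ℝ≥0∞} {G : Set (Set X)} (hG : G ⊆ T) (h : ∀ I ∈ G, c * μ I ≤ ν I) :
    c * μ (⋃₀ G) ≤ ν (⋃₀ G) := by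
  classical
  rcases G.eq_empty_or_nonempty with rfl | hne
  · simp
  obtain ⟨e, rfl⟩ := (hT.countable.mono hG).exists_eq_range hne
  have hacc : ∀ n, accumulate e n = ⋃ I ∈ (Finset.range (n + 1)).image e, I := by
    intro n
    ext x
    simp [accumulate]
  rw [sUnion_range, measure_iUnion_eq_iSup_accumulate, measure_iUnion_eq_iSup_accumulate,
    ENNReal.mul_iSup]
  refine iSup_mono fun n => ?_
  rw [hacc]
  refine hT.mul_measure_biUnion_finset_le hν _ (fun I hI => ?_) fun I hI => ?_
  · obtain ⟨i, -, rfl⟩ := Finset.mem_image.1 hI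
    exact hG (mem_range_self i)
  · obtain ⟨i, -, rfl⟩ := Finset.mem_image.1 hI
    exact h _ (mem_range_self i)

theorem setOf_lt_maximalFn (φ : X → ℝ) (c : ℝ≥0∞) :
    {x | c < maximalFn μ T φ x} =
      ⋃₀ {I ∈ T | c < (∫⁻ y in I, ENNReal.ofReal |φ y| ∂μ) / μ I} := by
  ext x
  simp only [maximalFn, lt_iSup_iff, mem_ofPred_eq, mem_sUnion]
  constructor
  · rintro ⟨I, hI, hx, h⟩
    exact ⟨I, ⟨hI, h⟩, hx⟩
  · rintro ⟨I, ⟨hI, h⟩, hx⟩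
    exact ⟨I, hI, hx, h⟩

theorem IsTree.measurableSet_lt_maximalFn (hT : IsTree μ T C) (φ : X → ℝ) (c : ℝ≥0∞) :
    MeasurableSet {x | c < maximalFn μ T φ x} := by
  rw [setOf_lt_maximalFn]
  exact MeasurableSet.sUnion (hT.countable.mono (sep_subset _ _))
    fun I hI => hT.measurableSet I hI.1

/-- The weak type `(1, 1)` inequality, localized to the level set. -/
theorem IsTree.mul_measure_lt_maximalFn_le (hT : IsTree μ T C) (φ : X → ℝ) (c : ℝ≥0∞) :
    c * μ {x | c < maximalFn μ T φ x} ≤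
      ∫⁻ x in {x | c < maximalFn μ T φ x}, ENNReal.ofReal |φ x| ∂μ := by
  have hm := hT.measurableSet_lt_maximalFn φ c
  rw [← withDensity_apply _ hm, setOf_lt_maximalFn]
  refine hT.mul_measure_sUnion_le (withDensity_absolutelyContinuous _ _) (sep_subset _ _) ?_
  rintro I ⟨hI, h⟩
  rw [withDensity_apply _ (hT.measurableSet I hI)]
  exact ENNReal.mul_le_of_le_div h.le

end Tree

/-! ### The decreasing rearrangement below the envelope. -/

section Rearrangement

variable {X : Type*} [MeasurableSpace X] {μ : Measure X}

/-- The decreasing rearrangement of `φ` on `(0, ∞)`, extended by zero. -/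
def rearrangement (μ : Measure X) (φ : X → ℝ) (t : ℝ) : ℝ :=
  if 0 < t then sInf {s | 0 ≤ s ∧ μ {x | s < φ x} ≤ ENNReal.ofReal t} else 0

theorem rearrangement_nonneg (φ : X → ℝ) (t : ℝ) : 0 ≤ rearrangement μ φ t := by
  unfold rearrangement
  split_ifs
  · exact Real.sInf_nonneg fun s hs => hs.1
  · rfl

theorem rearrangement_le {φ : X → ℝ} {s t : ℝ} (hs : 0 ≤ s)
    (h : μ {x | s < φ x} ≤ ENNReal.ofReal t) : rearrangement μ φ t ≤ s := by
  unfold rearrangement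
  split_ifs
  · exact csInf_le ⟨0, fun s hs => hs.1⟩ ⟨hs, h⟩
  · exact hs

variable {p : ℝ}

theorem rearrangement_le_envelope (hp : 1 < p) {φ : X → ℝ} {t : ℝ} (ht : 0 < t)
    (hφ : ∀ t, 0 < t → μ {x | envelope p t < φ x} ≤ ENNReal.ofReal t) :
    rearrangement μ φ t ≤ envelope p t :=
  rearrangement_le (envelope_nonneg hp ht.le) (hφ t ht)

/-- The infimum is attained, by continuity of measure from below. The envelope bound makes the set
nonempty, so the infimum is not the default value `0`. -/
theorem measure_lt_le_of_rearrangement_le (hp : 1 < p) {φ : X → ℝ} {s t : ℝ} (ht : 0 < t)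
    (hφ : ∀ t, 0 < t → μ {x | envelope p t < φ x} ≤ ENNReal.ofReal t)
    (h : rearrangement μ φ t ≤ s) : μ {x | s < φ x} ≤ ENNReal.ofReal t := by
  have e : {x | s < φ x} = ⋃ n : ℕ, {x | s + 1 / ((n : ℝ) + 1) < φ x} := by
    ext x
    simp only [mem_ofPred_eq, mem_iUnion]
    constructor
    · intro hx
      obtain ⟨n, hn⟩ := exists_nat_one_div_lt (sub_pos.2 hx)
      exact ⟨n, by linarith⟩
    · rintro ⟨n, hn⟩
      have : (0 : ℝ) < 1 / ((n : ℝ) + 1) := by positivity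
      linarith
  have hmono : Monotone fun n : ℕ => {x | s + 1 / ((n : ℝ) + 1) < φ x} := by
    intro m n hmn x hx
    simp only [mem_ofPred_eq] at hx ⊢
    have := Nat.one_div_le_one_div (α := ℝ) hmn
    linarith
  rw [e, hmono.measure_iUnion]
  refine iSup_le fun n => ?_
  rw [rearrangement, if_pos ht] at h
  have hn : (0 : ℝ) < 1 / ((n : ℝ) + 1) := by positivity
  obtain ⟨r, ⟨-, hr⟩, hrs⟩ := exists_lt_of_csInf_lt
    (s := {s | 0 ≤ s ∧ μ {x | s < φ x} ≤ ENNReal.ofReal t}) ⟨envelope p t, envelope_nonneg hp ht.le, hφ t ht⟩ (h.trans_lt (lt_add_of_pos_right s hn))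
  exact (measure_mono fun x hx => hrs.trans hx).trans hr

theorem lt_rearrangement_iff [IsProbabilityMeasure μ] (hp : 1 < p) {φ : X → ℝ} {s t : ℝ}
    (hs : 0 ≤ s) (hφ : ∀ t, 0 < t → μ {x | envelope p t < φ x} ≤ ENNReal.ofReal t) :
    s < rearrangement μ φ t ↔ 0 < t ∧ t < μ.real {x | s < φ x} := by
  by_cases ht : 0 < t
  · rw [← not_iff_not, not_lt, not_and, not_lt]
    have hE : μ {x | s < φ x} ≤ ENNReal.ofReal t ↔ μ.real {x | s < φ x} ≤ t := by
      rw [measureReal_def, ENNReal.le_ofReal_iff_toReal_le (measure_ne_top _ _) ht.le]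
    rw [← hE]
    exact ⟨fun h _ => measure_lt_le_of_rearrangement_le hp ht hφ h,
      fun h => rearrangement_le hs (h ht)⟩
  · simp [ht, rearrangement, hs]

theorem preimage_rearrangement_Ioi [IsProbabilityMeasure μ] (hp : 1 < p) {φ : X → ℝ} {s : ℝ}
    (hs : 0 ≤ s) (hφ : ∀ t, 0 < t → μ {x | envelope p t < φ x} ≤ ENNReal.ofReal t) :
    rearrangement μ φ ⁻¹' Ioi s = Ioo 0 (μ.real {x | s < φ x}) := by
  ext t
  exact lt_rearrangement_iff hp hs hφ

theorem preimage_rearrangement_Ioi_of_neg (φ : X → ℝ) {s : ℝ} (hs : s < 0) :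
    rearrangement μ φ ⁻¹' Ioi s = univ :=
  eq_univ_of_forall fun t => hs.trans_le (rearrangement_nonneg φ t)

theorem measurable_rearrangement [IsProbabilityMeasure μ] (hp : 1 < p) {φ : X → ℝ}
    (hφ : ∀ t, 0 < t → μ {x | envelope p t < φ x} ≤ ENNReal.ofReal t) :
    Measurable (rearrangement μ φ) := by
  refine measurable_of_Ioi fun s => ?_
  rcases lt_or_ge s 0 with hs | hs
  · rw [preimage_rearrangement_Ioi_of_neg φ hs]
    exact MeasurableSet.univ
  · rw [preimage_rearrangement_Ioi hp hs hφ]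
    exact measurableSet_Ioo

theorem antitoneOn_rearrangement [IsProbabilityMeasure μ] (hp : 1 < p) {φ : X → ℝ}
    (hφ : ∀ t, 0 < t → μ {x | envelope p t < φ x} ≤ ENNReal.ofReal t) :
    AntitoneOn (rearrangement μ φ) (Ioi 0) := by
  intro s hs t _ hst
  by_contra! h
  have := (lt_rearrangement_iff hp (rearrangement_nonneg φ s) hφ).1 h
  exact absurd ((lt_rearrangement_iff hp (rearrangement_nonneg φ s) hφ).2
    ⟨hs, hst.trans_lt this.2⟩) (lt_irrefl _)

theorem map_rearrangement [IsProbabilityMeasure μ] (hp : 1 < p) {φ : X → ℝ} (hm : Measurable φ)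
    (h0 : ∀ x, 0 ≤ φ x) (hφ : ∀ t, 0 < t → μ {x | envelope p t < φ x} ≤ ENNReal.ofReal t) :
    (volume.restrict (Ioc (0 : ℝ) 1)).map (rearrangement μ φ) = μ.map φ := by
  have hψ := measurable_rearrangement hp hφ
  have : IsProbabilityMeasure (volume.restrict (Ioc (0 : ℝ) 1)) := ⟨by simp⟩
  have : IsProbabilityMeasure ((volume.restrict (Ioc (0 : ℝ) 1)).map (rearrangement μ φ)) :=
    Measure.isProbabilityMeasure_map hψ.aemeasurable
  have : IsProbabilityMeasure (μ.map φ) := Measure.isProbabilityMeasure_map hm.aemeasurable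
  refine Measure.ext_of_Iic _ _ fun s => ?_
  rw [← compl_Ioi, prob_compl_eq_one_sub measurableSet_Ioi, prob_compl_eq_one_sub measurableSet_Ioi,
    Measure.map_apply hψ measurableSet_Ioi, Measure.map_apply hm measurableSet_Ioi]
  congr 1
  rcases lt_or_ge s 0 with hs | hs
  · rw [preimage_rearrangement_Ioi_of_neg φ hs, measure_univ,
      show φ ⁻¹' Ioi s = univ from eq_univ_of_forall fun x => hs.trans_le (h0 x), measure_univ]
  · rw [preimage_rearrangement_Ioi hp hs hφ, Measure.restrict_apply measurableSet_Ioo,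
      inter_eq_left.2 ((Ioo_subset_Ioo_right measureReal_le_one).trans Ioo_subset_Ioc_self),
      Real.volume_Ioo, sub_zero, ofReal_measureReal]
    rfl

theorem integral_comp_rearrangement [IsProbabilityMeasure μ] (hp : 1 < p) {φ : X → ℝ}
    (hm : Measurable φ) (h0 : ∀ x, 0 ≤ φ x)
    (hφ : ∀ t, 0 < t → μ {x | envelope p t < φ x} ≤ ENNReal.ofReal t) {g : ℝ → ℝ}
    (hg : Measurable g) :
    ∫ t in (0 : ℝ)..1, g (rearrangement μ φ t) = ∫ x, g (φ x) ∂μ := by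
  rw [intervalIntegral.integral_of_le zero_le_one,
    ← integral_map (measurable_rearrangement hp hφ).aemeasurable hg.aestronglyMeasurable,
    map_rearrangement hp hm h0 hφ, integral_map hm.aemeasurable hg.aestronglyMeasurable]

theorem isProfile_rearrangement [IsProbabilityMeasure μ] (hp : 1 < p) {φ : X → ℝ}
    (hφ : ∀ t, 0 < t → μ {x | envelope p t < φ x} ≤ ENNReal.ofReal t) :
    IsProfile p (rearrangement μ φ) :=
  ⟨measurable_rearrangement hp hφ, fun t _ => rearrangement_nonneg φ t,
    fun _ ht => rearrangement_le_envelope hp ht.1 hφ⟩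

/-- Integrals over sets are bounded by integrals of the rearrangement (Hardy-Littlewood). -/
theorem setIntegral_le_integral_rearrangement [IsProbabilityMeasure μ] (hp : 1 < p) {φ : X → ℝ}
    (hm : Measurable φ) (h0 : ∀ x, 0 ≤ φ x) (hi : Integrable φ μ)
    (hφ : ∀ t, 0 < t → μ {x | envelope p t < φ x} ≤ ENNReal.ofReal t) {E : Set X}
    (hpos : 0 < μ.real E) :
    ∫ x in E, φ x ∂μ ≤ ∫ t in (0 : ℝ)..(μ.real E), rearrangement μ φ t := by
  have hb1 : μ.real E ≤ 1 := measureReal_le_one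
  set b := μ.real E with hb
  set ψ := rearrangement μ φ with hψ
  set s := ψ b with hs
  have hs0 : 0 ≤ s := rearrangement_nonneg φ b
  have hprof : IsProfile p ψ := isProfile_rearrangement hp hφ
  have hanti := antitoneOn_rearrangement hp hφ
  have h1 : ∫ x, max (φ x - s) 0 ∂μ = ∫ t in (0 : ℝ)..1, max (ψ t - s) 0 :=
    (integral_comp_rearrangement hp hm h0 hφ (g := fun y => max (y - s) 0) (by fun_prop)).symm
  have i1 : Integrable (fun x => max (φ x - s) 0) μ :=
    (hi.sub (integrable_const s)).sup (integrable_zero _ _ _)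
  have i2 : ∀ a c, 0 ≤ a → a ≤ c → c ≤ 1 →
      IntervalIntegrable (fun t => max (ψ t - s) 0) volume a c := by
    intro a c ha hac hc
    have h := (hprof.intervalIntegrable hp ha hac hc).sub (intervalIntegrable_const (c := s))
    rw [intervalIntegrable_iff] at h ⊢
    exact h.sup (integrable_zero _ _ _)
  have h2 : ∫ t in (0 : ℝ)..1, max (ψ t - s) 0 = (∫ t in (0 : ℝ)..b, ψ t) - s * b := by
    rw [← intervalIntegral.integral_add_adjacent_intervals (i2 0 b le_rfl hpos.le hb1)
      (i2 b 1 hpos.le hb1 le_rfl),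
      intervalIntegral.integral_congr_Ioo_of_le (g := fun t => ψ t - s) hpos.le,
      intervalIntegral.integral_congr_Ioo_of_le (g := fun _ => (0 : ℝ)) hb1,
      intervalIntegral.integral_sub (hprof.intervalIntegrable hp le_rfl hpos.le hb1)
        intervalIntegrable_const]
    · simp [mul_comm]
    · exact fun t ht => max_eq_right (sub_nonpos.2
        (hanti (mem_Ioi.2 hpos) (mem_Ioi.2 (hpos.trans ht.1)) ht.1.le))
    · exact fun t ht => max_eq_left (sub_nonneg.2
        (hanti (mem_Ioi.2 ht.1) (mem_Ioi.2 hpos) ht.2.le))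
  -- With `s` the rearrangement at `b`, one has `φ ≤ s + (φ - s)⁺`. The positive part has the same
  -- integral for `φ` and its rearrangement, and the latter exceeds `s` only on `(0, b)`.
  have h3 : ∫ x in E, φ x ∂μ ≤ ∫ x in E, (s + max (φ x - s) 0) ∂μ := by
    refine setIntegral_mono hi.integrableOn
      ((integrable_const s).add i1).integrableOn fun x => ?_
    have := le_max_left (φ x - s) 0
    simp only
    linarith
  rw [integral_add (integrable_const s) i1.integrableOn, setIntegral_const, smul_eq_mul, ← hb] at h3
  have h4 : ∫ x in E, max (φ x - s) 0 ∂μ ≤ ∫ x, max (φ x - s) 0 ∂μ :=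
    setIntegral_le_integral i1 (ae_of_all _ fun x => le_max_right _ _)
  linarith

/-- The value at `b` lies between the means over `(b, a]` and `(0, b]`, so the means over initial
intervals decrease. -/
theorem mul_integral_le_mul_integral_of_antitoneOn {ψ : ℝ → ℝ} (hψ : AntitoneOn ψ (Ioi 0))
    {a b : ℝ} (hb : 0 < b) (hba : b ≤ a) (hi : IntervalIntegrable ψ volume 0 a) :
    b * ∫ t in (0 : ℝ)..a, ψ t ≤ a * ∫ t in (0 : ℝ)..b, ψ t := by
  have ha := hb.trans_le hba
  have i1 : IntervalIntegrable ψ volume 0 b :=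
    hi.mono_set (by rw [uIcc_of_le hb.le, uIcc_of_le ha.le]; exact Icc_subset_Icc_right hba)
  have i2 : IntervalIntegrable ψ volume b a :=
    hi.mono_set (by rw [uIcc_of_le hba, uIcc_of_le ha.le]; exact Icc_subset_Icc_left hb.le)
  have h1 : b * ψ b ≤ ∫ t in (0 : ℝ)..b, ψ t := by
    have := intervalIntegral.integral_mono_on_of_le_Ioo hb.le
      (intervalIntegrable_const (c := ψ b)) i1
      fun t ht => hψ (mem_Ioi.2 ht.1) (mem_Ioi.2 hb) ht.2.le
    simpa using this
  have h2 : ∫ t in b..a, ψ t ≤ (a - b) * ψ b := by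
    have := intervalIntegral.integral_mono_on_of_le_Ioo hba i2
      (intervalIntegrable_const (c := ψ b))
      fun t ht => hψ (mem_Ioi.2 hb) (mem_Ioi.2 (hb.trans ht.1)) ht.1.le
    simpa using this
  rw [← intervalIntegral.integral_add_adjacent_intervals i1 i2]
  nlinarith [mul_le_mul_of_nonneg_left h2 hb.le,
    mul_le_mul_of_nonneg_left h1 (sub_nonneg.2 hba)]

end Rearrangement

/-! ### From admissible functions to profiles. -/

section UpperBound

variable {X : Type*} [MeasurableSpace X] {μ : Measure X}
  {T : Set (Set X)} {C : Set X → Set (Set X)} {p q f A l : ℝ} {φ : X → ℝ}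

theorem div_envelope_rpow (hp : 1 < p) {t : ℝ} (ht : 0 < t) :
    ((p - 1) / p / envelope p t) ^ p = t := by
  have hκ : (p - 1) / p ≠ 0 := (div_pos (by linarith) (by linarith)).ne'
  rw [envelope, div_mul_eq_div_div, div_self hκ, Real.rpow_neg ht.le, one_div, inv_inv,
    ← Real.rpow_mul ht.le, one_div_mul_cancel (by linarith), Real.rpow_one]

theorem IsAdmissible.measure_envelope_lt (h : IsAdmissible μ p q f A φ) (hp : 1 < p) {t : ℝ}
    (ht : 0 < t) : μ {x | envelope p t < φ x} ≤ ENNReal.ofReal t := by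
  have he := envelope_pos hp ht
  have hp0 : 0 < p := by linarith
  have h1 : ENNReal.ofReal (envelope p t) * (μ {x | envelope p t ≤ φ x}) ^ (1 / p) ≤
      ENNReal.ofReal ((p - 1) / p) :=
    (le_iSup₂ (f := fun (s : ℝ) (_ : 0 < s) =>
      ENNReal.ofReal s * (μ {x | s ≤ φ x}) ^ (1 / p)) _ he).trans h.weakNorm_le
  refine (measure_mono fun x (hx : envelope p t < φ x) => hx.le).trans
    (b := μ {x | envelope p t ≤ φ x}) ?_
  rw [mul_comm, ← ENNReal.le_div_iff_mul_le (Or.inl (by simpa using he)) (Or.inl (by simp)),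
    ← ENNReal.ofReal_div_of_pos he] at h1
  have h2 := ENNReal.rpow_le_rpow h1 hp0.le
  rwa [← ENNReal.rpow_mul, one_div_mul_cancel hp0.ne', ENNReal.rpow_one,
    ENNReal.ofReal_rpow_of_nonneg (div_nonneg (div_nonneg (by linarith) hp0.le) he.le) hp0.le,
    div_envelope_rpow hp ht] at h2

variable [IsProbabilityMeasure μ]

theorem IsAdmissible.mul_le_integral_rearrangement (h : IsAdmissible μ p q f A φ)
    (hT : IsTree μ T C) (hp : 1 < p) (hl : 0 < l) {b : ℝ}
    (hb : b = μ.real {x | ENNReal.ofReal l ≤ maximalFn μ T φ x}) (hb0 : 0 < b) :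
    l * b ≤ ∫ t in (0 : ℝ)..b, rearrangement μ φ t := by
  have hφ := fun t ht => h.measure_envelope_lt hp (t := t) ht
  have hprof := isProfile_rearrangement hp hφ
  refine le_of_forall_lt_imp_le_of_dense fun y hy => ?_
  -- The weak type inequality concerns strict level sets, so it is used at levels `r < l`, whose
  -- sets contain `{Mφ ≥ l}`. Passing back to the smaller measure `b` is allowed because initial
  -- means decrease; the term `l / 2` only keeps `r` positive.
  obtain ⟨r, hr0, hrl, hyr⟩ : ∃ r, 0 < r ∧ r < l ∧ y ≤ r * b := by
    refine ⟨max (y / b) (l / 2), (half_pos hl).trans_le (le_max_right _ _),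
      max_lt ((div_lt_iff₀ hb0).2 hy) (half_lt_self hl), ?_⟩
    rw [← div_le_iff₀ hb0]
    exact le_max_left _ _
  refine hyr.trans ?_
  set E := {x | ENNReal.ofReal r < maximalFn μ T φ x} with hE
  have hbE : b ≤ μ.real E := by
    rw [hb]
    exact measureReal_mono fun x hx =>
      ((ENNReal.ofReal_lt_ofReal_iff hl).2 hrl).trans_le hx
  have hE0 : 0 < μ.real E := hb0.trans_le hbE
  have h1 : r * μ.real E ≤ ∫ x in E, φ x ∂μ := by
    have h2 := hT.mul_measure_lt_maximalFn_le φ (ENNReal.ofReal r)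
    simp only [abs_of_nonneg (h.nonneg _)] at h2
    rw [← hE, ← ofReal_integral_eq_lintegral_ofReal h.integrable.integrableOn
      (ae_of_all _ h.nonneg), ← ofReal_measureReal (measure_ne_top μ E),
      ← ENNReal.ofReal_mul hr0.le] at h2
    exact (ENNReal.ofReal_le_ofReal_iff (integral_nonneg h.nonneg)).1 h2
  have h2 := h1.trans (setIntegral_le_integral_rearrangement hp h.measurable h.nonneg
    h.integrable hφ hE0)
  have h3 := mul_integral_le_mul_integral_of_antitoneOn (antitoneOn_rearrangement hp hφ) hb0 hbE
    (hprof.intervalIntegrable hp le_rfl hE0.le measureReal_le_one)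
  have h4 := mul_le_mul_of_nonneg_left h2 hb0.le
  refine le_of_mul_le_mul_left ?_ hE0
  linarith

/-- An admissible function gives a decreasing profile whose mean over `(0, b]` is `l` for some `b`
not smaller than the measure of the level set of the maximal function. -/
theorem IsAdmissible.exists_profile (h : IsAdmissible μ p q f A φ)
    (hT : IsTree μ T C) (hp : 1 < p) (hf : 0 < f) (hl : f < l)
    (hb0 : 0 < μ.real {x | ENNReal.ofReal l ≤ maximalFn μ T φ x}) :
    ∃ ψ b, IsProfile p ψ ∧ AntitoneOn ψ (Ioi 0) ∧ ∫ t in (0 : ℝ)..1, ψ t = f ∧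
      ∫ t in (0 : ℝ)..1, ψ t ^ q = A ∧ ∫ t in (0 : ℝ)..b, ψ t = l * b ∧ b < 1 ∧
      μ.real {x | ENNReal.ofReal l ≤ maximalFn μ T φ x} ≤ b := by
  have hφ := fun t ht => h.measure_envelope_lt hp (t := t) ht
  have hprof := isProfile_rearrangement hp hφ
  have hmean : ∫ t in (0 : ℝ)..1, rearrangement μ φ t = f := by
    rw [integral_comp_rearrangement hp h.measurable h.nonneg hφ (g := fun y => y) measurable_id,
      h.integral_eq]
  have hmom : ∫ t in (0 : ℝ)..1, rearrangement μ φ t ^ q = A := by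
    rw [integral_comp_rearrangement hp h.measurable h.nonneg hφ (g := fun y => y ^ q)
      (by fun_prop), h.integral_rpow_eq]
  have hle := h.mul_le_integral_rearrangement hT hp (hf.trans hl) rfl hb0
  set b₀ := μ.real {x | ENNReal.ofReal l ≤ maximalFn μ T φ x}
  have hcont : ContinuousOn (fun b => (∫ t in (0 : ℝ)..b, rearrangement μ φ t) - l * b)
      (Icc b₀ 1) := by
    refine ContinuousOn.sub ?_ (by fun_prop)
    have hi : IntegrableOn (rearrangement μ φ) (uIcc 0 1) := by
      rw [uIcc_of_le zero_le_one, integrableOn_Icc_iff_integrableOn_Ioc]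
      exact hprof.integrableOn hp
    have := intervalIntegral.continuousOn_primitive_interval hi
    rw [uIcc_of_le zero_le_one] at this
    exact this.mono (Icc_subset_Icc_left hb0.le)
  -- The mean is at least `l` over `(0, b₀]` and equals `f < l` over `(0, 1]`, so it equals `l`
  -- somewhere in between.
  obtain ⟨b, hb, hb'⟩ := intermediate_value_Icc' measureReal_le_one hcont
    (show (0 : ℝ) ∈ _ from ⟨by rw [hmean]; linarith, by linarith⟩)
  refine ⟨_, b, hprof, antitoneOn_rearrangement hp hφ, hmean, hmom, by linarith, ?_, hb.1⟩
  refine hb.2.lt_of_ne fun h1 => ?_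
  simp only [h1, hmean] at hb'
  linarith

end UpperBound

/-! ### Uniform random variables adapted to the tree. -/

section Uniform

open ProbabilityTheory

theorem continuous_cdf (ρ : Measure ℝ) [IsProbabilityMeasure ρ] (h : ∀ y, ρ {y} = 0) :
    Continuous (cdf ρ) := by
  refine continuous_iff_continuousAt.2 fun y => ?_
  rw [(monotone_cdf ρ).continuousAt_iff_leftLim_eq_rightLim, StieltjesFunction.rightLim_eq]
  refine le_antisymm ((monotone_cdf ρ).leftLim_le le_rfl) ?_
  have := h y
  rw [← measure_cdf ρ, StieltjesFunction.measure_singleton, ENNReal.ofReal_eq_zero] at this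
  linarith

/-- The probability integral transform. -/
theorem map_cdf (ρ : Measure ℝ) [IsProbabilityMeasure ρ] (h : ∀ y, ρ {y} = 0) :
    ρ.map (cdf ρ) = volume.restrict (Ioc 0 1) := by
  have hc := continuous_cdf ρ h
  have hm : Measurable (cdf ρ) := hc.measurable
  have : IsProbabilityMeasure (ρ.map (cdf ρ)) := Measure.isProbabilityMeasure_map hm.aemeasurable
  refine Measure.ext_of_Iic _ _ fun t => ?_
  rw [Measure.map_apply hm measurableSet_Iic, Measure.restrict_apply measurableSet_Iic,
    inter_comm, Ioc_inter_Iic, Real.volume_Ioc, sub_zero]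
  rcases lt_or_ge t 0 with ht | ht
  · rw [show cdf ρ ⁻¹' Iic t = ∅ from
        eq_empty_of_forall_notMem fun y hy => absurd (cdf_nonneg ρ y) (not_le.2 (lt_of_le_of_lt hy ht)),
      measure_empty, ENNReal.ofReal_of_nonpos ((min_le_right _ _).trans ht.le)]
  rcases le_or_gt 1 t with ht1 | ht1
  · rw [show cdf ρ ⁻¹' Iic t = univ from
        eq_univ_of_forall fun y => (cdf_le_one ρ y).trans ht1, measure_univ, min_eq_left ht1,
      ENNReal.ofReal_one]
  have hivt : ∀ s ∈ Ioo (0 : ℝ) 1, ∃ y, cdf ρ y = s := by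
    intro s hs
    obtain ⟨y, hy⟩ := ((tendsto_cdf_atBot ρ).eventually_lt_const hs.1).exists
    obtain ⟨z, hz⟩ := ((tendsto_cdf_atTop ρ).eventually_const_lt hs.2).exists
    exact mem_range_of_exists_le_of_exists_ge hc ⟨y, hy.le⟩ ⟨z, hz.le⟩
  rw [min_eq_right ht1.le, ← ofReal_measureReal]
  congr 1
  refine le_antisymm ?_ ?_
  · refine le_of_forall_gt_imp_ge_of_dense fun s hs => ?_
    rcases le_or_gt 1 s with hs1 | hs1
    · exact measureReal_le_one.trans hs1
    obtain ⟨y, hy⟩ := hivt s ⟨ht.trans_lt hs, hs1⟩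
    rw [← hy, cdf_eq_real]
    refine measureReal_mono fun z hz => ?_
    by_contra hyz
    have := monotone_cdf ρ (not_le.1 hyz).le
    rw [hy] at this
    exact absurd (this.trans hz) (not_le.2 hs)
  · rcases ht.eq_or_lt with rfl | ht0
    · exact measureReal_nonneg
    obtain ⟨y, hy⟩ := hivt t ⟨ht0, ht1⟩
    nth_rewrite 1 [← hy]
    rw [cdf_eq_real]
    exact measureReal_mono fun z hz => (monotone_cdf ρ hz).trans hy.le

theorem map_affine_restrict_Ioc {a b : ℝ} (hab : a < b) :
    (volume.restrict (Ioc (0 : ℝ) 1)).map (fun u => a + (b - a) * u) =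
      ENNReal.ofReal (1 / (b - a)) • volume.restrict (Ioc a b) := by
  have hba : 0 < b - a := sub_pos.2 hab
  have hm : Measurable fun u : ℝ => a + (b - a) * u := by fun_prop
  refine Measure.ext_of_Iic _ _ fun t => ?_
  have hpre : (fun u : ℝ => a + (b - a) * u) ⁻¹' Iic t = Iic ((t - a) / (b - a)) := by
    ext u
    simp only [mem_preimage, mem_Iic, le_div_iff₀ hba]
    constructor <;> intro h <;> linarith
  have hmin : min 1 ((t - a) / (b - a)) = 1 / (b - a) * (min b t - a) := by
    rw [← min_sub_sub_right, mul_min_of_nonneg _ _ (by positivity), one_div_mul_cancel hba.ne']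
    congr 1
    ring
  rw [Measure.map_apply hm measurableSet_Iic, hpre, Measure.smul_apply,
    Measure.restrict_apply measurableSet_Iic, Measure.restrict_apply measurableSet_Iic, inter_comm,
    Ioc_inter_Iic, inter_comm (Iic t), Ioc_inter_Iic, Real.volume_Ioc, Real.volume_Ioc, sub_zero,
    smul_eq_mul, ← ENNReal.ofReal_mul (by positivity)]
  exact congrArg ENNReal.ofReal hmin

variable {X : Type*} [MeasurableSpace X] {μ : Measure X}
  {T : Set (Set X)} {C : Set X → Set (Set X)}

/-- A random variable that generates the tree has no atoms. -/
theorem IsTree.exists_null_fibers (hT : IsTree μ T C) :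
    ∃ Y : X → ℝ, Measurable Y ∧ ∀ y, μ (Y ⁻¹' {y}) = 0 := by
  classical
  obtain ⟨e, he⟩ := hT.countable.exists_eq_range ⟨univ, hT.univ_mem⟩
  have heT : ∀ n, e n ∈ T := fun n => he ▸ mem_range_self n
  -- The value at `x` encodes which elements of the countable tree contain `x`. A fibre through `x₀`
  -- therefore lies in every tree element that contains `x₀`, and these have arbitrarily small
  -- measure.
  refine ⟨fun x => embeddingReal (ℕ → Bool) fun n => decide (x ∈ e n), ?_, fun y => ?_⟩
  · refine (measurableEmbedding_embeddingReal _).measurable.comp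
      (measurable_pi_lambda _ fun n => ?_)
    refine measurable_to_bool ?_
    have : (fun x => decide (x ∈ e n)) ⁻¹' {true} = e n := by ext x; simp
    rw [this]
    exact hT.measurableSet _ (heT n)
  · rcases ((fun x => embeddingReal (ℕ → Bool) fun n => decide (x ∈ e n)) ⁻¹' {y}).eq_empty_or_nonempty
      with h | ⟨x₀, hx₀⟩
    · rw [h, measure_empty]
    refine le_antisymm (ge_of_tendsto' hT.tendsto_level fun m => ?_) zero_le
    obtain ⟨I, hI, hxI⟩ := hT.exists_mem_level m x₀
    refine (measure_mono fun x hx => ?_).trans (le_iSup₂ (f := fun I (_ : I ∈ treeLevel C m) => μ I)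
      I hI)
    obtain ⟨n, hn⟩ : I ∈ range e := he ▸ hT.level_subset m hI
    have h1 := (measurableEmbedding_embeddingReal (ℕ → Bool)).injective
      ((show _ = y from hx).trans (show _ = y from hx₀).symm)
    have h2 := congrFun h1 n
    simp only [decide_eq_decide, hn] at h2
    exact h2.2 hxI

theorem exists_piecewise {ι : Type*} [Fintype ι] {P : ι → Set X} (hP : ∀ i, MeasurableSet (P i))
    (hd : Pairwise (Function.onFun Disjoint P)) (hu : ⋃ i, P i = univ) {W : ι → X → ℝ}
    (hW : ∀ i, Measurable (W i)) :
    ∃ V : X → ℝ, Measurable V ∧ (∀ i, (μ.restrict (P i)).map V = (μ.restrict (P i)).map (W i)) ∧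
      μ.map V = ∑ i, (μ.restrict (P i)).map (W i) := by
  classical
  set V : X → ℝ := fun x => ∑ i, (P i).indicator (W i) x with hV
  have hVm : Measurable V := Finset.measurable_sum _ fun i _ => (hW i).indicator (hP i)
  have hmap : ∀ i, (μ.restrict (P i)).map V = (μ.restrict (P i)).map (W i) := by
    intro i
    refine Measure.map_congr ?_
    filter_upwards [ae_restrict_mem (hP i)] with x hx
    simp only [hV]
    rw [Finset.sum_eq_single i, indicator_of_mem hx]
    · intro j _ hji
      exact indicator_of_notMem (fun hj => (hd hji).le_bot ⟨hj, hx⟩) _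
    · simp
  refine ⟨V, hVm, hmap, ?_⟩
  have hsum : μ = Measure.sum fun i => μ.restrict (P i) := by
    rw [← Measure.restrict_iUnion hd hP, hu, Measure.restrict_univ]
  ext s hs
  conv_lhs => rw [hsum]
  rw [Measure.sum_fintype, Measure.map_apply hVm hs, Measure.finsetSum_apply,
    Measure.finsetSum_apply]
  refine Finset.sum_congr rfl fun i _ => ?_
  rw [← hmap i, Measure.map_apply hVm hs]

variable [IsProbabilityMeasure μ]

theorem IsTree.exists_uniform (hT : IsTree μ T C) (S : Set X) :
    ∃ U : X → ℝ, Measurable U ∧ (μ.restrict S).map U = μ S • volume.restrict (Ioc (0 : ℝ) 1) := by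
  obtain ⟨Y, hY, hY0⟩ := hT.exists_null_fibers
  -- Conditioning on `S` requires positive measure; for a null set both sides vanish.
  by_cases hS : μ S = 0
  · refine ⟨0, measurable_const, ?_⟩
    rw [hS, Measure.restrict_eq_zero.2 hS, Measure.map_zero, zero_smul]
  have : IsProbabilityMeasure (cond μ S) := cond_isProbabilityMeasure hS
  have : IsProbabilityMeasure ((cond μ S).map Y) := Measure.isProbabilityMeasure_map hY.aemeasurable
  have hρ : ∀ y, (cond μ S).map Y {y} = 0 := fun y => by
    rw [Measure.map_apply hY (measurableSet_singleton y)]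
    exact cond_absolutelyContinuous (hY0 y)
  have hc := continuous_cdf _ hρ
  refine ⟨cdf ((cond μ S).map Y) ∘ Y, hc.measurable.comp hY, ?_⟩
  have h := map_cdf _ hρ
  rw [Measure.map_map hc.measurable hY] at h
  have e : μ.restrict S = μ S • ProbabilityTheory.cond μ S := by
    rw [ProbabilityTheory.cond, smul_smul, ENNReal.mul_inv_cancel hS (measure_ne_top μ S), one_smul]
  rw [← h, e, Measure.map_smul]

theorem IsTree.exists_uniform_Ioc (hT : IsTree μ T C) (S : Set X) {a b : ℝ} (hab : a < b) :
    ∃ U : X → ℝ, Measurable U ∧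
      (μ.restrict S).map U = (μ S * ENNReal.ofReal (1 / (b - a))) • volume.restrict (Ioc a b) := by
  obtain ⟨U, hU, h⟩ := hT.exists_uniform S
  refine ⟨fun x => a + (b - a) * U x, by fun_prop, ?_⟩
  have hm : Measurable fun u : ℝ => a + (b - a) * u := by fun_prop
  rw [← Function.comp_def (fun u : ℝ => a + (b - a) * u) U, ← Measure.map_map hm hU, h,
    Measure.map_smul, map_affine_restrict_Ioc hab, smul_smul]

theorem IsTree.exists_subset_measure_eq (hT : IsTree μ T C) {Q : Set X} (hQ : MeasurableSet Q)
    {r : ℝ} (hr : 0 ≤ r) (hrQ : r ≤ μ.real Q) (hQ0 : 0 < μ.real Q) :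
    ∃ R ⊆ Q, MeasurableSet R ∧ μ.real R = r := by
  obtain ⟨U, hU, h⟩ := hT.exists_uniform Q
  refine ⟨Q ∩ U ⁻¹' Iic (r / μ.real Q), inter_subset_left, hQ.inter (hU measurableSet_Iic), ?_⟩
  have h1 := congrArg (fun ν : Measure ℝ => ν (Iic (r / μ.real Q))) h
  simp only [Measure.map_apply hU measurableSet_Iic,
    Measure.restrict_apply (hU measurableSet_Iic), Measure.smul_apply,
    Measure.restrict_apply measurableSet_Iic] at h1
  rw [inter_comm, measureReal_def, h1, inter_comm, Ioc_inter_Iic, Real.volume_Ioc, sub_zero,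
    min_eq_right ((div_le_one hQ0).2 hrQ), smul_eq_mul, ENNReal.toReal_mul,
    ENNReal.toReal_ofReal (by positivity), ← measureReal_def, mul_div_cancel₀ _ hQ0.ne']

/-- Finitely many almost disjoint tree elements fill up almost any prescribed measure. -/
theorem IsTree.exists_finset_measure (hT : IsTree μ T C) {b ε : ℝ} (hb : 0 ≤ b) (hb1 : b < 1)
    (hε : 0 < ε) :
    ∃ R : Finset (Set X), (∀ I ∈ R, I ∈ T) ∧ (R : Set (Set X)).Pairwise (AEDisjoint μ) ∧
      ∑ I ∈ R, μ.real I ≤ b ∧ b - ε < ∑ I ∈ R, μ.real I := by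
  classical
  obtain ⟨m, hm⟩ := (hT.tendsto_level.eventually_lt_const (ENNReal.ofReal_pos.2 hε)).exists
  have hsmall : ∀ I ∈ treeLevel C m, μ.real I < ε := by
    intro I hI
    rw [measureReal_def]
    refine (ENNReal.toReal_lt_of_lt_ofReal ?_)
    exact (le_iSup₂ (f := fun I (_ : I ∈ treeLevel C m) => μ I) I hI).trans_lt hm
  have hone : ∑' I : treeLevel C m, μ (I : Set X) = 1 := by
    rw [← measure_biUnion₀ (f := fun I : Set X => I) (hT.level_countable m)
      (hT.level_aedisjoint m)
      fun I hI => (hT.measurableSet I (hT.level_subset m hI)).nullMeasurableSet,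
      show ⋃ I ∈ treeLevel C m, I = univ from eq_univ_of_forall fun x => by
        obtain ⟨I, hI, hx⟩ := hT.exists_mem_level m x
        exact mem_biUnion (t := fun I : Set X => I) hI hx, measure_univ]
  obtain ⟨F, hF⟩ : ∃ F : Finset (treeLevel C m), ENNReal.ofReal b < ∑ I ∈ F, μ (I : Set X) := by
    rw [← lt_iSup_iff, ← ENNReal.tsum_eq_iSup_sum, hone]
    simpa using hb1
  have hF' : b < ∑ I ∈ F, μ.real (I : Set X) := by
    rw [← ENNReal.ofReal_lt_ofReal_iff_of_nonneg hb,
      ENNReal.ofReal_sum_of_nonneg fun _ _ => measureReal_nonneg]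
    simpa using hF
  -- A subfamily of largest cardinality with total at most `b`: one more element of the finite
  -- family `F` would exceed `b`, and each element has measure below `ε`.
  obtain ⟨R, hR, hmax⟩ := (F.powerset.filter fun R : Finset (treeLevel C m) =>
    ∑ I ∈ R, μ.real (I : Set X) ≤ b).exists_max_image Finset.card ⟨∅, by simp [hb]⟩
  simp only [Finset.mem_filter, Finset.mem_powerset] at hR hmax
  obtain ⟨J, hJF, hJR⟩ : ∃ J ∈ F, J ∉ R := by
    by_contra! h
    have := Finset.Subset.antisymm hR.1 h
    rw [this] at hR
    linarith [hR.2]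
  have hJ : b < ∑ I ∈ insert J R, μ.real (I : Set X) := by
    by_contra! h
    have := hmax _ ⟨Finset.insert_subset hJF hR.1, h⟩
    rw [Finset.card_insert_of_notMem hJR] at this
    omega
  rw [Finset.sum_insert hJR] at hJ
  have := hsmall J J.2
  refine ⟨R.map (Function.Embedding.subtype _), ?_, ?_, ?_, ?_⟩
  · intro I hI
    obtain ⟨K, -, rfl⟩ := Finset.mem_map.1 hI
    exact hT.level_subset m K.2
  · refine (hT.level_aedisjoint m).mono fun I hI => ?_
    obtain ⟨K, -, rfl⟩ := Finset.mem_map.1 (Finset.mem_coe.1 hI)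
    exact K.2
  · rw [Finset.sum_map]
    exact hR.2
  · rw [Finset.sum_map]
    simp only [Function.Embedding.subtype_apply]
    linarith

/-- A uniform random variable on `(0, 1]` whose law on each of finitely many almost disjoint
tree elements is uniform on `(0, b]`. -/
theorem IsTree.exists_uniform_of_finset (hT : IsTree μ T C) {b : ℝ} (hb : 0 < b) (hb1 : b < 1)
    {R : Finset (Set X)} (hR : ∀ I ∈ R, I ∈ T) (hd : (R : Set (Set X)).Pairwise (AEDisjoint μ))
    (hsum : ∑ I ∈ R, μ.real I ≤ b) :
    ∃ W : X → ℝ, Measurable W ∧ μ.map W = volume.restrict (Ioc 0 1) ∧ ∀ I ∈ R,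
      (μ.restrict I).map W = (μ I * ENNReal.ofReal (1 / b)) • volume.restrict (Ioc 0 b) := by
  classical
  obtain ⟨t, ht, ht0, hdis⟩ := exists_null_pairwise_disjoint_sdiff (μ := μ)
    (s := fun i : R => (i : Set X)) fun i j hij => hd i.2 j.2 (Subtype.coe_injective.ne hij)
  set D : R → Set X := fun i => (i : Set X) \ t i with hD
  have hDm : ∀ i, MeasurableSet (D i) := fun i => (hT.measurableSet _ (hR _ i.2)).diff (ht i)
  have hDae : ∀ i, D i =ᵐ[μ] (i : Set X) := fun i => sdiff_null_ae_eq_self (ht0 i)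
  have hDμ : ∀ i, μ (D i) = μ (i : Set X) := fun i => measure_congr (hDae i)
  set E := ⋃ i, D i with hE
  have hEm : MeasurableSet E := MeasurableSet.iUnion hDm
  have hEμ : μ.real E = ∑ I ∈ R, μ.real I := by
    rw [measureReal_def, hE, measure_iUnion hdis hDm, tsum_fintype,
      ENNReal.toReal_sum fun _ _ => measure_ne_top _ _, ← Finset.sum_coe_sort R]
    exact Finset.sum_congr rfl fun i _ => by rw [hDμ, measureReal_def]
  have hQ := probReal_compl_eq_one_sub (μ := μ) hEm
  -- The set `S` fills the union of the chosen elements up to measure `b`. The variable is uniform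
  -- on `(0, b]` over each element and over `S`, and uniform on `(b, 1]` over the remainder `Z`, so
  -- the laws add up to Lebesgue measure on `(0, 1]`.
  obtain ⟨S, hSQ, hSm, hSμ⟩ := hT.exists_subset_measure_eq hEm.compl (r := b - μ.real E)
    (by linarith) (by linarith) (by linarith)
  set Z := Eᶜ \ S with hZ
  have hZm : MeasurableSet Z := hEm.compl.diff hSm
  have hZμ : μ.real Z = 1 - b := by
    rw [hZ, measureReal_sdiff hSQ hSm, hQ, hSμ]; ring
  choose U hU hUmap using fun i => hT.exists_uniform_Ioc (D i) hb
  obtain ⟨US, hUS, hUSmap⟩ := hT.exists_uniform_Ioc S hb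
  obtain ⟨UZ, hUZ, hUZmap⟩ := hT.exists_uniform_Ioc Z hb1
  set P : Option (Option R) → Set X := fun o => o.elim Z fun o => o.elim S D with hPdef
  set V : Option (Option R) → X → ℝ := fun o => o.elim UZ fun o => o.elim US U with hVdef
  have hDE : ∀ i, D i ⊆ E := fun i => subset_iUnion D i
  have hDS : ∀ i, Disjoint (D i) S := fun i =>
    disjoint_left.2 fun x hx hxS => hSQ hxS (hDE i hx)
  have hDZ : ∀ i, Disjoint (D i) Z := fun i =>
    disjoint_left.2 fun x hx hxZ => hxZ.1 (hDE i hx)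
  have hSZ : Disjoint S Z := disjoint_sdiff_right
  obtain ⟨W, hWm, hWi, hW⟩ := exists_piecewise (μ := μ) (P := P) (W := V)
    (by rintro (_ | _ | i); exacts [hZm, hSm, hDm i])
    (by
      rintro (_ | _ | i) (_ | _ | j) hij
      · exact absurd rfl hij
      · exact hSZ.symm
      · exact (hDZ j).symm
      · exact hSZ
      · exact absurd rfl hij
      · exact (hDS j).symm
      · exact hDZ i
      · exact hDS i
      · exact hdis fun h => hij (by rw [h]))
    (by
      refine eq_univ_of_forall fun x => mem_iUnion.2 ?_
      by_cases hxE : x ∈ E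
      · obtain ⟨i, hi⟩ := mem_iUnion.1 hxE
        exact ⟨some (some i), hi⟩
      · by_cases hxS : x ∈ S
        · exact ⟨some none, hxS⟩
        · exact ⟨none, hxE, hxS⟩)
    (by rintro (_ | _ | i); exacts [hUZ, hUS, hU i])
  refine ⟨W, hWm, ?_, fun I hI => ?_⟩
  · rw [hW, Fintype.sum_option, Fintype.sum_option]
    simp only [hPdef, hVdef, Option.elim]
    simp only [hUmap, hUSmap, hUZmap, sub_zero]
    have h1 : μ Z * ENNReal.ofReal (1 / (1 - b)) = 1 := by
      rw [← ofReal_measureReal (measure_ne_top μ Z), hZμ, ← ENNReal.ofReal_mul (by linarith),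
        mul_one_div_cancel (by linarith), ENNReal.ofReal_one]
    have h2 : μ S * ENNReal.ofReal (1 / b) + ∑ i, μ (D i) * ENNReal.ofReal (1 / b) = 1 := by
      have h3 : ∑ i, μ (D i) = μ E := by rw [hE, measure_iUnion hdis hDm, tsum_fintype]
      rw [← Finset.sum_mul, h3, ← add_mul, ← ofReal_measureReal (measure_ne_top μ S),
        ← ofReal_measureReal (measure_ne_top μ E), hSμ, ← ENNReal.ofReal_add (by linarith)
        measureReal_nonneg, sub_add_cancel, ← ENNReal.ofReal_mul hb.le,
        mul_one_div_cancel hb.ne', ENNReal.ofReal_one]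
    rw [← Finset.sum_smul, ← add_smul, h1, h2, one_smul, one_smul, add_comm,
      ← Measure.restrict_union (Ioc_disjoint_Ioc_of_le le_rfl) measurableSet_Ioc,
      Ioc_union_Ioc_eq_Ioc hb.le hb1.le]
  · have h := hWi (some (some ⟨I, hI⟩))
    simp only [hPdef, hVdef, Option.elim] at h
    rw [hUmap, hDμ, Measure.restrict_congr_set (hDae _), sub_zero] at h
    exact h

end Uniform

/-! ### From profiles to admissible functions. -/

section LowerBound

variable {X : Type*} [MeasurableSpace X] {μ : Measure X}
  {T : Set (Set X)} {C : Set X → Set (Set X)} {p q f A l b : ℝ} {ψ : ℝ → ℝ}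

/-- Profiles are constrained only on `(0, 1]`, whereas a composition with a random variable must be
nonnegative at every point. -/
theorem IsProfile.indicator (h : IsProfile p ψ) : IsProfile p ((Ioc (0 : ℝ) 1).indicator ψ) where
  measurable := h.measurable.indicator measurableSet_Ioc
  nonneg t ht := by rw [indicator_of_mem ht]; exact h.nonneg t ht
  le_envelope t ht := by rw [indicator_of_mem ht]; exact h.le_envelope t ht

theorem envelope_mul_rpow {c : ℝ} (hc : 0 < c) : envelope p c * c ^ (1 / p) = (p - 1) / p := by
  rw [envelope, mul_assoc, ← Real.rpow_add hc, neg_add_cancel, Real.rpow_zero, mul_one]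

/-- A function with the distribution of a profile is admissible. -/
theorem IsProfile.isAdmissible_comp (h : IsProfile p ψ) (hq : 1 < q) (hqp : q < p)
    (h0 : ∀ t, 0 ≤ ψ t) (hψ0 : ∀ t ∉ Ioc (0 : ℝ) 1, ψ t = 0)
    (hf : ∫ t in (0 : ℝ)..1, ψ t = f) (hA : ∫ t in (0 : ℝ)..1, ψ t ^ q = A) {W : X → ℝ}
    (hW : Measurable W) (hmap : μ.map W = volume.restrict (Ioc 0 1)) :
    IsAdmissible μ p q f A (fun x => ψ (W x)) where
  measurable := h.measurable.comp hW
  nonneg x := h0 _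
  integrable := by
    have := h.integrableOn (by linarith)
    rw [IntegrableOn, ← hmap] at this
    exact this.comp_measurable hW
  integral_eq := by
    rw [← integral_map hW.aemeasurable h.measurable.aestronglyMeasurable, hmap,
      ← intervalIntegral.integral_of_le zero_le_one, hf]
  integrable_rpow := by
    have := h.integrableOn_rpow hq hqp
    rw [IntegrableOn, ← hmap] at this
    exact this.comp_measurable hW
  integral_rpow_eq := by
    rw [← integral_map hW.aemeasurable (f := fun t => ψ t ^ q)
      (h.measurable.pow_const q).aestronglyMeasurable, hmap,
      ← intervalIntegral.integral_of_le zero_le_one, hA]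
  weakNorm_le := by
    have hp : 1 < p := by linarith
    refine iSup₂_le fun t ht => ?_
    obtain ⟨c, hc, rfl⟩ := exists_envelope_eq hp ht
    have h1 : μ {x | envelope p c ≤ ψ (W x)} ≤ ENNReal.ofReal c := by
      have hm : MeasurableSet {w | envelope p c ≤ ψ w} :=
        measurableSet_le measurable_const h.measurable
      have e : μ {x | envelope p c ≤ ψ (W x)} = μ.map W {w | envelope p c ≤ ψ w} := by
        rw [Measure.map_apply hW hm]; rfl
      rw [e, hmap]
      refine (Measure.restrict_apply_le _ _).trans ?_
      refine (measure_mono (t := Ioc 0 c) fun w hw => ?_).trans (by simp)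
      by_cases hw1 : w ∈ Ioc (0 : ℝ) 1
      · exact ⟨hw1.1, le_of_envelope_le hp hc
          ((show envelope p c ≤ ψ w from hw).trans (h.le_envelope w hw1))⟩
      · rw [mem_ofPred_eq, hψ0 w hw1] at hw
        exact absurd hw (not_le.2 ht)
    refine (mul_le_mul_right (ENNReal.rpow_le_rpow h1 (by positivity)) _).trans ?_
    rw [ENNReal.ofReal_rpow_of_nonneg hc.le (by positivity), ← ENNReal.ofReal_mul ht.le,
      envelope_mul_rpow hc]

theorem average_le_maximalFn (φ : X → ℝ) {I : Set X} (hI : I ∈ T) {x : X} (hx : x ∈ I) :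
    (∫⁻ y in I, ENNReal.ofReal |φ y| ∂μ) / μ I ≤ maximalFn μ T φ x :=
  le_iSup₂_of_le I hI (le_iSup (fun _ : x ∈ I => (∫⁻ y in I, ENNReal.ofReal |φ y| ∂μ) / μ I) hx)

variable [IsProbabilityMeasure μ]

/-- A profile with mean `l` over `(0, b]` is realized by an admissible function whose maximal
function is at least `l` on a set of measure almost `b`. -/
theorem IsProfile.exists_isAdmissible (h : IsProfile p ψ) (hT : IsTree μ T C) (hq : 1 < q)
    (hqp : q < p) (hf : ∫ t in (0 : ℝ)..1, ψ t = f) (hA : ∫ t in (0 : ℝ)..1, ψ t ^ q = A)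
    (hb : 0 < b) (hb1 : b < 1) (hl : ∫ t in (0 : ℝ)..b, ψ t = l * b) {ε : ℝ} (hε : 0 < ε) :
    ∃ φ : X → ℝ, IsAdmissible μ p q f A φ ∧
      b - ε < μ.real {x | ENNReal.ofReal l ≤ maximalFn μ T φ x} := by
  have hp : 1 < p := by linarith
  set χ := (Ioc (0 : ℝ) 1).indicator ψ with hχ
  have hχp : IsProfile p χ := h.indicator
  have hχ0 : ∀ t, 0 ≤ χ t := fun t => indicator_nonneg (fun t ht => h.nonneg t ht) t
  have heq : ∀ t ∈ Ioo (0 : ℝ) 1, χ t = ψ t := fun t ht =>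
    indicator_of_mem (Ioo_subset_Ioc_self ht) ψ
  have hf' : ∫ t in (0 : ℝ)..1, χ t = f := by
    rw [← hf]; exact intervalIntegral.integral_congr_Ioo_of_le zero_le_one heq
  have hA' : ∫ t in (0 : ℝ)..1, χ t ^ q = A := by
    rw [← hA]
    exact intervalIntegral.integral_congr_Ioo_of_le zero_le_one fun t ht => by
      simp only [heq t ht]
  have hl' : ∫ t in (0 : ℝ)..b, χ t = l * b := by
    rw [← hl]
    exact intervalIntegral.integral_congr_Ioo_of_le hb.le fun t ht =>
      heq t ⟨ht.1, ht.2.trans hb1⟩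
  obtain ⟨R, hRT, hRd, hR1, hR2⟩ := hT.exists_finset_measure hb.le hb1 hε
  obtain ⟨W, hW, hmap, hWR⟩ := hT.exists_uniform_of_finset hb hb1 hRT hRd hR1
  have hadm := hχp.isAdmissible_comp hq hqp hχ0 (fun t ht => indicator_of_notMem ht ψ) hf' hA' hW hmap
  refine ⟨_, hadm, hR2.trans_le ?_⟩
  have hsum : ∑ I ∈ R, μ.real I = μ.real (⋃ I ∈ R, I) := by
    rw [measureReal_def, measure_biUnion_finset₀ hRd
      fun I hI => (hT.measurableSet I (hRT I hI)).nullMeasurableSet,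
      ENNReal.toReal_sum fun _ _ => measure_ne_top _ _]
    rfl
  rw [hsum]
  refine measureReal_mono (iUnion₂_subset fun I hI x hx => ?_)
  refine le_trans (le_of_eq ?_) (average_le_maximalFn _ (hRT I hI) hx)
  have hI0 : μ I ≠ 0 := (hT.measure_pos I (hRT I hI)).ne'
  have hint : ∫⁻ t in Ioc 0 b, ENNReal.ofReal (χ t) = ENNReal.ofReal (l * b) := by
    rw [← hl', intervalIntegral.integral_of_le hb.le, ofReal_integral_eq_lintegral_ofReal
      ((hχp.integrableOn hp).mono_set (Ioc_subset_Ioc_right hb1.le)) (ae_of_all _ hχ0)]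
  -- On each chosen `I` the law is that of the profile on `(0, b]`, so the average over `I` is
  -- exactly `l` and `Mφ ≥ l` on all of `I`.
  have : ∫⁻ y in I, ENNReal.ofReal |χ (W y)| ∂μ = μ I * ENNReal.ofReal l := by
    simp only [abs_of_nonneg (hχ0 _)]
    rw [← lintegral_map (f := fun t => ENNReal.ofReal (χ t))
      hχp.measurable.ennreal_ofReal hW, hWR I hI, lintegral_smul_measure, hint, smul_eq_mul,
      mul_assoc, ← ENNReal.ofReal_mul (by positivity)]
    congr 2
    field_simp
  rw [this, mul_comm, ENNReal.mul_div_cancel_right hI0 (measure_ne_top μ I)]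

end LowerBound

/-! ### Profiles with prescribed mass, moment and initial mean. -/

section Interpolation

variable {p q f A l b : ℝ}

/-- Between two profiles with the same means there are profiles with all intermediate moments. -/
theorem IsProfile.exists_interpolant {ψ₀ ψ₁ : ℝ → ℝ} (h₀ : IsProfile p ψ₀) (h₁ : IsProfile p ψ₁)
    (hq : 1 < q) (hqp : q < p) (hA₀ : ∫ t in (0 : ℝ)..1, ψ₀ t ^ q ≤ A)
    (hA₁ : A ≤ ∫ t in (0 : ℝ)..1, ψ₁ t ^ q) :
    ∃ ψ, IsProfile p ψ ∧ ∫ t in (0 : ℝ)..1, ψ t ^ q = A ∧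
      ∀ c m, 0 ≤ c → c ≤ 1 → ∫ t in (0 : ℝ)..c, ψ₀ t = m → ∫ t in (0 : ℝ)..c, ψ₁ t = m →
        ∫ t in (0 : ℝ)..c, ψ t = m := by
  have hp : 1 < p := by linarith
  have hprof : ∀ s ∈ Icc (0 : ℝ) 1, IsProfile p fun t => (1 - s) * ψ₀ t + s * ψ₁ t := by
    intro s hs
    refine ⟨(h₀.measurable.const_mul _).add (h₁.measurable.const_mul _), fun t ht => ?_,
      fun t ht => ?_⟩
    · exact add_nonneg (mul_nonneg (by linarith [hs.2]) (h₀.nonneg t ht))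
        (mul_nonneg hs.1 (h₁.nonneg t ht))
    · have e1 := mul_le_mul_of_nonneg_left (h₀.le_envelope t ht) (by linarith [hs.2] : 0 ≤ 1 - s)
      have e2 := mul_le_mul_of_nonneg_left (h₁.le_envelope t ht) hs.1
      linarith
  -- Along the segment from `ψ₀` to `ψ₁` the moment is continuous by domination with the envelope,
  -- while linear constraints shared by the endpoints persist.
  have hcont : ContinuousOn (fun s : ℝ => ∫ t in (0 : ℝ)..1, ((1 - s) * ψ₀ t + s * ψ₁ t) ^ q)
      (Icc 0 1) := by
    simp only [intervalIntegral.integral_of_le (zero_le_one' ℝ)]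
    refine continuousOn_of_dominated (bound := fun t => envelope p t ^ q)
      (fun s hs => ((hprof s hs).measurable.pow_const q).aestronglyMeasurable) (fun s hs => ?_)
      (integrableOn_envelope_rpow hq hqp) (ae_of_all _ fun t => ?_)
    · filter_upwards [ae_restrict_mem measurableSet_Ioc] with t ht
      rw [Real.norm_of_nonneg (Real.rpow_nonneg ((hprof s hs).nonneg t ht) _)]
      exact Real.rpow_le_rpow ((hprof s hs).nonneg t ht) ((hprof s hs).le_envelope t ht)
        (by linarith)
    · refine ContinuousOn.rpow_const (by fun_prop) fun _ _ => Or.inr (by linarith)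
  obtain ⟨s, hs, hsA⟩ := intermediate_value_Icc zero_le_one hcont
    (show A ∈ _ from ⟨by simpa using hA₀, by simpa using hA₁⟩)
  refine ⟨_, hprof s hs, hsA, fun c m hc hc1 e₀ e₁ => ?_⟩
  rw [intervalIntegral.integral_add ((h₀.intervalIntegrable hp le_rfl hc hc1).const_mul _)
    ((h₁.intervalIntegrable hp le_rfl hc hc1).const_mul _), intervalIntegral.integral_const_mul,
    intervalIntegral.integral_const_mul, e₀, e₁]
  ring

theorem IsProfile.integral_glue {ψ₁ ψ₂ : ℝ → ℝ} (h₁ : IsProfile p ψ₁) (h₂ : IsProfile p ψ₂)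
    (hp : 1 < p) (hb : 0 ≤ b) (hb1 : b ≤ 1) :
    ∫ t in (0 : ℝ)..1, DyadicWeakType.glue b ψ₁ ψ₂ t = (∫ t in (0 : ℝ)..b, ψ₁ t) + ∫ t in b..1, ψ₂ t := by
  have h := h₁.glue h₂ b
  rw [← intervalIntegral.integral_add_adjacent_intervals (h.intervalIntegrable hp le_rfl hb hb1)
    (h.intervalIntegrable hp hb hb1 le_rfl), integral_glue_left (fun x => x) hb le_rfl,
    integral_glue_right (fun x => x) hb1 le_rfl]

theorem IsProfile.integral_glue_rpow {ψ₁ ψ₂ : ℝ → ℝ} (h₁ : IsProfile p ψ₁) (h₂ : IsProfile p ψ₂)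
    (hq : 1 < q) (hqp : q < p) (hb : 0 ≤ b) (hb1 : b ≤ 1) :
    ∫ t in (0 : ℝ)..1, DyadicWeakType.glue b ψ₁ ψ₂ t ^ q =
      (∫ t in (0 : ℝ)..b, ψ₁ t ^ q) + ∫ t in b..1, ψ₂ t ^ q := by
  have h := h₁.glue h₂ b
  rw [← intervalIntegral.integral_add_adjacent_intervals
    (h.intervalIntegrable_rpow hq hqp le_rfl hb hb1)
    (h.intervalIntegrable_rpow hq hqp hb hb1 le_rfl), integral_glue_left (fun x => x ^ q) hb le_rfl,
    integral_glue_right (fun x => x ^ q) hb1 le_rfl]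

theorem one_sub_div_pos (hq : 1 < q) (hqp : q < p) : 0 < 1 - q / p := by
  have : q / p < 1 := by rw [div_lt_one (by linarith)]; exact hqp
  linarith

theorem exists_cutoff (hq : 1 < q) (hqp : q < p) {m : ℝ} (hb : 0 ≤ b) (hb1 : b ≤ 1) (hm : 0 ≤ m)
    (hmb : m ≤ b ^ (1 - 1 / p)) :
    ∃ c, c ^ (1 - 1 / p) = m ∧ 0 ≤ c ∧ c ≤ b ∧ ∫ t in (0 : ℝ)..b, cutoff p c t = m ∧
      ∫ t in (0 : ℝ)..b, cutoff p c t ^ q = Gam p q * m ^ ((p - q) / (p - 1)) := by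
  have hp : 1 < p := by linarith
  obtain ⟨c, hc, hcm⟩ := exists_rpow_eq hp hm
  have hcb : c ≤ b := by
    rwa [← Real.rpow_le_rpow_iff hc hb (one_sub_inv_pos hp), hcm]
  refine ⟨c, hcm, hc, hcb, ?_, ?_⟩
  · rw [integral_cutoff hp le_rfl hc hcb hb1, hcm, Real.zero_rpow (one_sub_inv_pos hp).ne', sub_zero]
  · rw [integral_cutoff_rpow hq hqp le_rfl hc hcb hb1, ← rpow_mul_exponent hp hc, hcm,
      Real.zero_rpow (one_sub_div_pos hq hqp).ne', sub_zero]

theorem Tfun_endpoint (hp : 1 < p) (hqp : q < p) (hl : 0 < l) :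
    Tfun p q l (1 / l ^ p) = Gam p q / l ^ (p - q) := by
  have hκ1 : (p - 1) / p < 1 := by rw [div_lt_one (by linarith)]; linarith
  have hκ0 : 0 < (p - 1) / p := div_pos (by linarith) (by linarith)
  have hlp := Real.rpow_pos_of_pos hl p
  have hn : ¬ 1 / l ^ p ≤ ((p - 1) / p / l) ^ p := by
    rw [not_le, Real.div_rpow hκ0.le hl.le, div_lt_div_iff_of_pos_right hlp]
    exact Real.rpow_lt_one hκ0.le hκ1 (by linarith)
  have hr : (p - q) / (p - 1) ≠ 0 := (div_pos (by linarith) (by linarith)).ne'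
  rw [Tfun, if_neg hn, rpow_one_div_rpow hp hl, sub_self, mul_zero, Real.zero_rpow hr,
    rpow_one_div_rpow' hp hl, Gam]
  ring

/-- At `l ^ (-p)` the value of `T` is the moment `Γ / l ^ (p - q)` of the envelope, so feasibility
there would mean that the left side of the root equation is at most `A`. -/
theorem lt_of_mem_feasible (hp : 1 < p) (hqp : q < p) (hf : 0 < f) (hl : 0 < l)
    (hroot : (1 / f) ^ (1 / (p - 1)) ≤ l → A < rootFun p q f l) (hb : b ∈ feasible p q f A l) :
    b < 1 / l ^ p := by
  obtain ⟨-, hle, -, hT, -⟩ := hb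
  refine (hle.trans (min_le_right _ _)).lt_of_ne fun h => ?_
  have h1 := hroot ((threshold_le_iff hp hf hl).2 (h ▸ hle.trans (min_le_left _ _)))
  rw [h, Tfun_endpoint hp hqp hl] at hT
  rw [rootFun] at h1
  linarith

/-- Every feasible number is realized by a profile. -/
theorem exists_profile_of_mem_feasible (hq : 1 < q) (hqp : q < p) (hl : f < l) (hf : 0 < f)
    (hb0 : 0 < b) (hbl : b < 1 / l ^ p) (hb : b ∈ feasible p q f A l) :
    b < 1 ∧ ∃ ψ, IsProfile p ψ ∧ ∫ t in (0 : ℝ)..1, ψ t = f ∧ ∫ t in (0 : ℝ)..1, ψ t ^ q = A ∧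
      ∫ t in (0 : ℝ)..b, ψ t = l * b := by
  have hp : 1 < p := by linarith
  have hl0 : 0 < l := hf.trans hl
  obtain ⟨-, hle, hm, hT, hS⟩ := hb
  have hbf := hle.trans (min_le_left _ _)
  have hb1 : b < 1 := hbf.trans_lt ((div_lt_one hl0).2 hl)
  rw [le_div_iff₀ hl0, mul_comm] at hbf
  have hlb := (mul_lt_rpow_iff hp hl0 hb0).2 hbl
  obtain ⟨w, hw, hw1⟩ := exists_height hp hb0 hb1 (sub_nonneg.2 hbf) hm
  have hF := Ffun_eq hq hqp hl hb0 hb1 hw hw1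
  obtain ⟨v, hv, hv1, hv2⟩ := exists_Tfun_eq hq hqp hl0 hb0 hb1.le hlb
  obtain ⟨c, -, -, -, hc1, hc2⟩ := exists_cutoff hq hqp hb0.le hb1.le (mul_pos hl0 hb0).le hlb.le
  have hW := isProfile_trunc hp hw.1
  have hV := isProfile_trunc hp hv
  have hK := isProfile_cutoff hp c
  obtain ⟨ψ, hψ, hψA, hψm⟩ := (hV.glue hW b).exists_interpolant (hK.glue hW b) hq hqp (A := A)
    (by rw [hV.integral_glue_rpow hW hq hqp hb0.le hb1.le, ← hv2, ← hF]; linarith)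
    (by
      rw [hK.integral_glue_rpow hW hq hqp hb0.le hb1.le, hc2, ← hF]
      rw [Sfun] at hS
      linarith)
  refine ⟨hb1, ψ, hψ, hψm 1 f zero_le_one le_rfl ?_ ?_, hψA, hψm b _ hb0.le hb1.le ?_ ?_⟩
  · rw [hV.integral_glue hW hp hb0.le hb1.le, hv1, hw1]; ring
  · rw [hK.integral_glue hW hp hb0.le hb1.le, hc1, hw1]; ring
  · rw [integral_glue_left (fun x => x) hb0.le le_rfl, hv1]
  · rw [integral_glue_left (fun x => x) hb0.le le_rfl, hc1]

/-- Beyond the root the level `l` is reached with the profile equal to the envelope on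
`(0, l ^ (-p)]`. -/
theorem exists_profile_of_rootFun_le (hq : 1 < q) (hqp : q < p) (hf : 0 < f) (hf1 : f < 1)
    (hA : A ≤ Gam p q * f ^ ((p - q) / (p - 1))) (hl : (1 / f) ^ (1 / (p - 1)) ≤ l)
    (hroot : rootFun p q f l ≤ A) :
    1 / l ^ p < 1 ∧ ∃ ψ, IsProfile p ψ ∧ ∫ t in (0 : ℝ)..1, ψ t = f ∧
      ∫ t in (0 : ℝ)..1, ψ t ^ q = A ∧ ∫ t in (0 : ℝ)..(1 / l ^ p), ψ t = l * (1 / l ^ p) := by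
  have hp : 1 < p := by linarith
  have hl1 : 1 < l := (one_lt_threshold hp hf hf1).trans_le hl
  have hl0 : 0 < l := by linarith
  have hlp : 0 < l ^ p := Real.rpow_pos_of_pos hl0 p
  have hb1 : 1 / l ^ p < 1 := by
    rw [div_lt_one hlp]; exact Real.one_lt_rpow hl1 (by linarith)
  have hb0 : 0 < 1 / l ^ p := by positivity
  have hbf := (threshold_le_iff hp hf hl0).1 hl
  rw [le_div_iff₀ hl0, mul_comm, ← rpow_one_div_rpow hp hl0] at hbf
  obtain ⟨v, hv, hm, he⟩ := exists_rootFun_eq hq hqp hf hf1 hl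
  rw [he] at hroot
  rw [← rpow_one_div_rpow hp hl0] at hm ⊢
  generalize 1 / l ^ p = b at *
  refine ⟨hb1, ?_⟩
  obtain ⟨c, hcf, hc0, hc1, hc2, hc3⟩ := exists_cutoff hq hqp zero_le_one le_rfl hf.le
    (by rw [Real.one_rpow]; exact hf1.le)
  -- The cutoff profile of mass `f` thus also equals the envelope on `(0, b]`, and both ends of the
  -- interpolation have mass `b ^ (1 - 1/p) = l * b` there.
  have hbc : b ≤ c := by
    rwa [← Real.rpow_le_rpow_iff hb0.le hc0 (one_sub_inv_pos hp), hcf]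
  have hE := isProfile_envelope hp
  have hV := isProfile_trunc hp hv.1
  obtain ⟨ψ, hψ, hψA, hψm⟩ := (hE.glue hV b).exists_interpolant (isProfile_cutoff hp c) hq hqp
    (A := A) (by
      rw [hE.integral_glue_rpow hV hq hqp hb0.le hb1.le,
        integral_envelope_rpow hq hqp le_rfl hb0.le, Real.zero_rpow (one_sub_div_pos hq hqp).ne',
        sub_zero]
      linarith)
    (by rw [hc3]; exact hA)
  refine ⟨ψ, hψ, hψm 1 f zero_le_one le_rfl ?_ hc2, hψA, hψm b _ hb0.le hb1.le ?_ ?_⟩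
  · rw [hE.integral_glue hV hp hb0.le hb1.le, integral_envelope hp, hm,
      Real.zero_rpow (one_sub_inv_pos hp).ne']
    ring
  · rw [integral_glue_left (fun x => x) hb0.le le_rfl, integral_envelope hp,
      Real.zero_rpow (one_sub_inv_pos hp).ne', sub_zero]
  · rw [cutoff_eq_glue, integral_glue_left (fun x => x) hb0.le hbc, integral_envelope hp,
      Real.zero_rpow (one_sub_inv_pos hp).ne', sub_zero]

/-- A decreasing profile whose mean over `(0, b]` is `l` yields a feasible number above `b`. -/
theorem IsProfile.exists_feasible {ψ : ℝ → ℝ} (hψ : IsProfile p ψ) (hanti : AntitoneOn ψ (Ioi 0))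
    (hq : 1 < q) (hqp : q < p) (hf : 0 < f) (hf1 : f < 1)
    (hA : A ≤ Gam p q * f ^ ((p - q) / (p - 1))) (hl : f < l)
    (hroot : (1 / f) ^ (1 / (p - 1)) ≤ l → A < rootFun p q f l)
    (hψf : ∫ t in (0 : ℝ)..1, ψ t = f) (hψA : ∫ t in (0 : ℝ)..1, ψ t ^ q = A)
    (hb0 : 0 < b) (hb1 : b < 1) (hψb : ∫ t in (0 : ℝ)..b, ψ t = l * b) :
    ∃ a, b ≤ a ∧ a ∈ feasible p q f A l := by
  have hp : 1 < p := by linarith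
  have hl0 : 0 < l := hf.trans hl
  have i : ∀ {a c : ℝ}, 0 ≤ a → a ≤ c → c ≤ 1 → IntervalIntegrable ψ volume a c :=
    fun h1 h2 h3 => hψ.intervalIntegrable hp h1 h2 h3
  have hsplit : ∀ a, 0 ≤ a → a ≤ 1 → (∫ t in (0 : ℝ)..a, ψ t) + ∫ t in a..1, ψ t = f :=
    fun a ha ha1 => by
      rw [← hψf, intervalIntegral.integral_add_adjacent_intervals (i le_rfl ha ha1)
        (i ha ha1 le_rfl)]
  have htail : ∫ t in b..1, ψ t = f - l * b := by
    have := hsplit b hb0.le hb1.le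
    rw [hψb] at this
    linarith
  have htail0 : 0 ≤ f - l * b := by
    rw [← htail, intervalIntegral.integral_of_le hb1.le]
    exact setIntegral_nonneg measurableSet_Ioc fun t ht => hψ.nonneg t ⟨hb0.trans ht.1, ht.2⟩
  -- For `a ≥ b` the mean over `(0, a]` is at most `l`, so the mass beyond `a` is at least `f - l *
  -- a`; the envelope bounds that mass from above.
  have hpath : ∀ a, b ≤ a → a ≤ 1 → f - l * a ≤ 1 - a ^ (1 - 1 / p) := by
    intro a hba ha1
    have ha0 := hb0.trans_le hba
    have h1 := mul_integral_le_mul_integral_of_antitoneOn hanti hb0 hba (i le_rfl ha0.le ha1)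
    have h2 : ∫ t in (0 : ℝ)..a, ψ t ≤ l * a := by
      refine le_of_mul_le_mul_left ?_ hb0
      rw [hψb] at h1
      linarith
    have h3 := hψ.integral_le hp ha0.le ha1 le_rfl
    rw [Real.one_rpow] at h3
    linarith [hsplit a ha0.le ha1]
  have hlb : l * b ≤ b ^ (1 - 1 / p) := by
    have := hψ.integral_le hp le_rfl hb0.le hb1.le
    rwa [hψb, Real.zero_rpow (one_sub_inv_pos hp).ne', sub_zero] at this
  have hbf : b ≤ f / l := by rw [le_div_iff₀ hl0, mul_comm]; linarith
  obtain ⟨w, hw, hw1⟩ := exists_height hp hb0 hb1 htail0 (hpath b le_rfl hb1.le)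
  have hF : Ffun p q f l b ≤ ∫ t in b..1, ψ t ^ q := by
    rw [Ffun_eq hq hqp hl hb0 hb1 hw hw1]
    exact integral_trunc_rpow_le hq hqp hψ hb0.le hb1.le le_rfl hw.1 (by rw [hw1, htail])
  rw [← intervalIntegral.integral_add_adjacent_intervals
    (hψ.intervalIntegrable_rpow hq hqp le_rfl hb0.le hb1.le)
    (hψ.intervalIntegrable_rpow hq hqp hb0.le hb1.le le_rfl)] at hψA
  -- Equality would give the profile the moment of the envelope on `(0, b]`, and its total moment
  -- `A` would be at least the left side of the root equation, contrary to `hroot`.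
  have hbl : b < 1 / l ^ p := by
    refine ((mul_le_rpow_iff hp hl0 hb0).1 hlb).lt_of_ne fun h => ?_
    have h1 := hroot ((threshold_le_iff hp hf hl0).2 (h ▸ hbf))
    have h2 : b ^ (1 - 1 / p) = l * b := by rw [h]; exact rpow_one_div_rpow hp hl0
    have h3 := hψ.integral_rpow_eq_of_integral_eq hq hqp le_rfl hb0.le hb1.le (by
      rw [hψb, h2, Real.zero_rpow (one_sub_inv_pos hp).ne', sub_zero])
    rw [Real.zero_rpow (one_sub_div_pos hq hqp).ne', sub_zero] at h3
    have h4 : b ^ (1 - q / p) = 1 / l ^ (p - q) := by rw [h]; exact rpow_one_div_rpow' hp hl0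
    rw [rootFun, ← h, div_eq_mul_one_div, ← h4] at h1
    linarith
  obtain ⟨v, hv, hv1, hv2⟩ := exists_Tfun_eq hq hqp hl0 hb0 hb1.le
    ((mul_lt_rpow_iff hp hl0 hb0).2 hbl)
  have hT : Tfun p q l b ≤ ∫ t in (0 : ℝ)..b, ψ t ^ q := by
    rw [hv2]
    exact integral_trunc_rpow_le hq hqp hψ le_rfl hb0.le hb1.le hv (by rw [hv1, hψb])
  exact DyadicWeakType.exists_feasible hq hqp hf hf1 hA hl hroot hb0 hbf hbl hpath (by linarith)

end Interpolation

/-! ### Comparison of profiles with the supremum. -/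

section Supremum

variable {X : Type*} [MeasurableSpace X] {μ : Measure X} [IsProbabilityMeasure μ]
  {T : Set (Set X)} {C : Set X → Set (Set X)} {p q f A l b : ℝ}

theorem measureReal_le_B1 {φ : X → ℝ} (h : IsAdmissible μ p q f A φ) :
    μ.real {x | ENNReal.ofReal l ≤ maximalFn μ T φ x} ≤ B1 μ T p q f A l := by
  refine le_csSup ⟨1, ?_⟩ ⟨φ, h, rfl⟩
  rintro _ ⟨φ, -, rfl⟩
  exact measureReal_le_one

theorem IsProfile.le_B1 {ψ : ℝ → ℝ} (h : IsProfile p ψ) (hT : IsTree μ T C) (hq : 1 < q)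
    (hqp : q < p) (hf : ∫ t in (0 : ℝ)..1, ψ t = f) (hA : ∫ t in (0 : ℝ)..1, ψ t ^ q = A)
    (hb : 0 < b) (hb1 : b < 1) (hl : ∫ t in (0 : ℝ)..b, ψ t = l * b) : b ≤ B1 μ T p q f A l := by
  refine le_of_forall_pos_le_add fun ε hε => ?_
  obtain ⟨φ, hφ, hlt⟩ := h.exists_isAdmissible (μ := μ) hT hq hqp hf hA hb hb1 hl hε
  have := measureReal_le_B1 (T := T) (l := l) hφ
  linarith

end Supremum

end

end DyadicWeakType

/-! ### The theorem. -/

theorem theorem4p1 {X : Type*} [MeasurableSpace X] (μ : Measure X) [IsProbabilityMeasure μ]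
    (hμ : IsNonatomic μ) (T : Set (Set X)) (C : Set X → Set (Set X)) (hT : IsTree μ T C)
    (p q : ℝ) (hq : 1 < q) (hqp : q < p)
    (f A : ℝ) (hD : (f, A) ∈ DyadicWeakType.D p q) (hA : Amin p q f < A) :
    ∃ l₁ : ℝ,
      -- `l₁` is a root in `[(1/f)^(1/(p-1)), ∞)`, the only one there
      ((1 / f) ^ (1 / (p - 1)) ≤ l₁ ∧
        Ffun p q f l₁ (1 / l₁ ^ p) + Gam p q / l₁ ^ (p - q) = A) ∧
      (∀ l : ℝ, (1 / f) ^ (1 / (p - 1)) ≤ l →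
        Ffun p q f l (1 / l ^ p) + Gam p q / l ^ (p - q) = A → l = l₁) ∧
      -- it lies in the open half-line unless `A` is the largest value allowed by `D`
      (A < Gam p q * f ^ ((p - q) / (p - 1)) → (1 / f) ^ (1 / (p - 1)) < l₁) ∧
      -- part (i)
      (∀ l : ℝ, l₁ ≤ l → B1 μ T p q f A l = 1 / l ^ p) ∧
      -- part (ii)
      (∀ l : ℝ, f < l → l < l₁ →
        IsLUB {b : ℝ | 0 ≤ b ∧ b ≤ min (f / l) (1 / l ^ p) ∧
            f - l * b ≤ 1 - b ^ (1 - 1 / p) ∧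
            Tfun p q l b ≤ A - Ffun p q f l b ∧ A - Ffun p q f l b ≤ Sfun p q l b}
          (B1 μ T p q f A l)) := by
  have hp : 1 < p := by linarith
  obtain ⟨hf, hf1', -, hA'⟩ := hD
  simp only at hf hf1' hA'
  -- For `f = 1` both bounds of the domain equal `Γ`, which leaves no room for `A_f < A`.
  have hf1 : f < 1 := by
    refine hf1'.lt_of_ne fun h => ?_
    rw [h, Real.one_rpow, mul_one] at hA'
    rw [h, Amin_one hq hqp] at hA
    linarith
  obtain ⟨l₁, hl₁, hr₁⟩ := exists_root hq hqp hf hf1 hA hA'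
  have hstrict := rootFun_strictAnti hq hqp hf hf1
  have hl₁1 : 1 < l₁ := (one_lt_threshold hp hf hf1).trans_le hl₁
  have hlow : ∀ l, l₁ ≤ l → 1 / l ^ p < 1 ∧ ∃ ψ, IsProfile p ψ ∧ ∫ t in (0 : ℝ)..1, ψ t = f ∧
      ∫ t in (0 : ℝ)..1, ψ t ^ q = A ∧ ∫ t in (0 : ℝ)..(1 / l ^ p), ψ t = l * (1 / l ^ p) :=
    fun l hl => exists_profile_of_rootFun_le hq hqp hf hf1 hA' (hl₁.trans hl)
      (hr₁ ▸ hstrict.antitoneOn hl₁ (hl₁.trans hl) hl)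
  have hpow : 0 < 1 / l₁ ^ p := by
    have := Real.rpow_pos_of_pos (by linarith : 0 < l₁) p
    positivity
  obtain ⟨φ₁, hφ₁, hpos₁⟩ : ∃ φ : X → ℝ, IsAdmissible μ p q f A φ ∧
      0 < μ.real {x | ENNReal.ofReal l₁ ≤ maximalFn μ T φ x} := by
    obtain ⟨h1, ψ, hψ, h2, h3, h4⟩ := hlow l₁ le_rfl
    -- With `ε` equal to `l₁ ^ (-p)` itself the level set has positive measure, and one such
    -- function suffices.
    obtain ⟨φ, hφ, hlt⟩ := hψ.exists_isAdmissible (μ := μ) hT hq hqp h2 h3 hpow h1 h4 hpow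
    exact ⟨φ, hφ, by linarith⟩
  refine ⟨l₁, ⟨hl₁, hr₁⟩, fun l hl h => hstrict.injOn hl hl₁ (h.trans hr₁.symm), fun hlt => ?_,
    fun l hl => le_antisymm ?_ ?_, fun l hfl hl => ⟨fun b hb => ?_, fun u hu => ?_⟩⟩
  · refine hl₁.lt_of_ne fun h => ?_
    rw [← h, rootFun_threshold hq hqp hf hf1] at hr₁
    linarith
  · have hl0 : 0 < l := by linarith
    refine csSup_le ⟨_, φ₁, hφ₁, rfl⟩ ?_
    rintro _ ⟨φ, hφ, rfl⟩
    rcases measureReal_nonneg.eq_or_lt with h0 | hb0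
    · rw [← h0]
      have := Real.rpow_pos_of_pos hl0 p
      positivity
    · rw [← mul_le_rpow_iff hp hl0 hb0]
      refine (hφ.mul_le_integral_rearrangement hT hp hl0 rfl hb0).trans ?_
      have := (isProfile_rearrangement hp fun t ht => hφ.measure_envelope_lt hp ht).integral_le hp
        le_rfl hb0.le measureReal_le_one
      rwa [Real.zero_rpow (one_sub_inv_pos hp).ne', sub_zero] at this
  · obtain ⟨h1, ψ, hψ, h2, h3, h4⟩ := hlow l hl
    have := Real.rpow_pos_of_pos (by linarith : 0 < l) p
    exact hψ.le_B1 hT hq hqp h2 h3 (by positivity) h1 h4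
  · have hroot : (1 / f) ^ (1 / (p - 1)) ≤ l → A < rootFun p q f l :=
      fun h => hr₁ ▸ hstrict h hl₁ hl
    rcases hb.1.eq_or_lt with h0 | hb0
    · rw [← h0]
      exact measureReal_nonneg.trans (measureReal_le_B1 hφ₁)
    · obtain ⟨h1, ψ, hψ, h2, h3, h4⟩ := exists_profile_of_mem_feasible hq hqp hfl hf hb0
        (lt_of_mem_feasible hp hqp hf (hf.trans hfl) hroot hb) hb
      exact hψ.le_B1 hT hq hqp h2 h3 hb0 h1 h4
  · have hroot : (1 / f) ^ (1 / (p - 1)) ≤ l → A < rootFun p q f l :=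
      fun h => hr₁ ▸ hstrict h hl₁ hl
    have hup : ∀ φ : X → ℝ, IsAdmissible μ p q f A φ →
        0 < μ.real {x | ENNReal.ofReal l ≤ maximalFn μ T φ x} →
        μ.real {x | ENNReal.ofReal l ≤ maximalFn μ T φ x} ≤ u := by
      intro φ hφ hb0
      obtain ⟨ψ, b, hψ, hanti, h1, h2, h3, h4, h5⟩ := hφ.exists_profile hT hp hf hfl hb0
      obtain ⟨a, hba, ha⟩ := hψ.exists_feasible hanti hq hqp hf hf1 hA' hfl hroot h1 h2
        (hb0.trans_le h5) h4 h3
      exact (h5.trans hba).trans (hu ha)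
    refine csSup_le ⟨_, φ₁, hφ₁, rfl⟩ ?_
    rintro _ ⟨φ, hφ, rfl⟩
    rcases measureReal_nonneg.eq_or_lt with h0 | hb0
    · rw [← h0]
      -- A null level set still requires `0 ≤ u`. Since `l < l₁`, the level set of `φ₁` at `l`
      -- contains the one at `l₁`, has positive measure, and so lies below some feasible number; in
      -- particular the feasible set is not empty.
      have hpos : 0 < μ.real {x | ENNReal.ofReal l ≤ maximalFn μ T φ₁ x} :=
        hpos₁.trans_le (measureReal_mono fun x hx => (ENNReal.ofReal_le_ofReal hl.le).trans hx)
      exact hpos.le.trans (hup φ₁ hφ₁ hpos)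
    · exact hup φ hφ hb0
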